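/- Let $A$ be a $C^*$-algebra and $k\in\mathbb N_0$. A $C^*$-correspondence over $A$ is a right Hilbert $A$-module $E$ with a left action of $A$ by adjointable operators, i.e. a $*$-homomorphism $\varphi\colon A\to\mathcal L(E)$; it is assumed essential: $\varphi(A)E$ spans a dense subspace of $E$. Let $\mathbb E=(\mathbb E(n))_{n\in\mathbb N_0^k}$ be a product system over $\mathbb N_0^k$ of essential $C^*$-correspondences over $A$: $\mathbb E(0)=A$, and there is an associative multiplication inducing isomorphisms of correspondences $\mathbb E(m)\otimes_A\mathbb E(n)\cong\mathbb E(m+n)$, which for $m=0$ or $n=0$ is given by the left, respectively right, action of $A$. Let $e_1,\dots,e_k$ be the standard basis of $\mathbb N_0^k$, put $E_i=\mathbb E(e_i)$, and let $t_{i,j}\colon E_i\otimes E_j\to E_j\otimes E_i$ be the isomorphism obtained from $E_i\otimes E_j\cong\mathbb E(e_i+e_j)\cong E_j\otimes E_i$. An *isometric representation* of $\mathbb E$ on a Hilbert space $H$ is a tuple $(\sigma,T^{(1)},\dots,T^{(k)})$, where $\sigma\colon A\to B(H)$ is a nondegenerate $*$-homomorphism and $T^{(i)}\colon E_i\to B(H)$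 are linear maps with $$T^{(i)}(a\xi b)=\sigma(a)T^{(i)}(\xi)\sigma(b),\qquad T^{(i)}(\xi)^*T^{(i)}(\eta)=\sigma(\langle\xi,\eta\rangle)\qquad(a,b\in A,\ \xi,\eta\in E_i),$$ such that the isometries $\widetilde T^{(i)}\colon E_i\otimes_\sigma H\to H$, $\xi\otimes h\mapsto T^{(i)}(\xi)h$, satisfy $$\widetilde T^{(i)}(I_{E_i}\otimes\widetilde T^{(j)})=\widetilde T^{(j)}(I_{E_j}\otimes\widetilde T^{(i)})(t_{i,j}\otimes I_H)\qquad\text{for all }i,j.$$ It is *doubly commuting* if $$\widetilde T^{(j)*}\,\widetilde T^{(i)}=(I_{E_j}\otimes\widetilde T^{(i)})(t_{i,j}\otimes I_H)(I_{E_i}\otimes\widetilde T^{(j)*})\qquad\text{for all }i\ne j.$$ For $1\le i\le k$ and $l\ge 0$ let $P^i_l$ be the orthogonal projection of $H$ onto the closed linear span of $\{T^{(i)}(\xi_1)\cdots T^{(i)}(\xi_l)h:\ \xi_1,\dots,\xi_l\in E_i,\ h\in H\}$, and let $P^i_\infty=\bigwedge_l P^i_l$ be the projection onto the intersection of these ranges.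 Let $\mathcal F(\mathbb E)=\bigoplus_{n\in\mathbb N_0^k}\mathbb E(n)$ be the Fock module (direct sum of Hilbert $A$-modules), with diagonal left action $\varphi_\infty$ of $A$, and for $\xi\in\mathbb E(m)$ let $T_\xi$ be the operator of left multiplication by $\xi$ on $\mathcal F(\mathbb E)$. For a nondegenerate $*$-homomorphism $\pi\colon A\to B(K)$, $K$ a Hilbert space, the *representation induced by $\pi$* acts on $\mathcal F(\mathbb E)\otimes_\pi K$ by $\sigma(a)=\varphi_\infty(a)\otimes I_K$ and $T^{(i)}(\xi)=T_\xi\otimes I_K$ for $\xi\in E_i$. Two representations are *isomorphic* if they are intertwined by a unitary. **Lemma.** Let $(\sigma,T^{(1)},\dots,T^{(k)})$ be a doubly commuting isometric representation of $\mathbb E$ on a Hilbert space $H$. Then it is isomorphic to a representation induced by some nondegenerate representation $\pi$ of $A$ if and only if $P^i_\infty=0$ for every $i\in\{1,\dots,k\}$. -/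

import Mathlib

open scoped TensorProduct InnerProductSpace

set_option linter.unusedSectionVars false

noncomputable section

namespace ProductSystemWold

open MulOpposite

universe u v w

section Positivity

variable {A : Type u} [NonUnitalCStarAlgebra A] [PartialOrder A] [StarOrderedRing A]

instance : StarOrderedRing Aᵐᵒᵖ :=
  StarOrderedRing.of_nonneg_iff' (fun {x y} h z => by
      change unop z + unop x ≤ unop z + unop y
      have h' : unop x ≤ unop y := h
      gcongr) (fun x => by
    change 0 ≤ unop x ↔ _
    rw [CStarAlgebra.nonneg_iff_eq_mul_star_self]
    constructor
    · rintro ⟨b, hb⟩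
      exact ⟨op b, unop_injective (by simpa using hb)⟩
    · rintro ⟨b, hb⟩
      exact ⟨unop b, by simpa using congrArg unop hb⟩)

theorem exists_negPart {B : Type*} [NonUnitalCStarAlgebra B] (m : B) (hm : IsSelfAdjoint m) :
    ∃ n e : B, star n = n ∧ n = star e * e ∧ m * n = - (n * n) ∧
      (n = 0 → ∃ c, m = star c * c) := by
  let _ : PartialOrder B := CStarAlgebra.spectralOrder B
  have : StarOrderedRing B := CStarAlgebra.spectralOrderedRing B
  obtain ⟨e, he⟩ := CStarAlgebra.nonneg_iff_eq_star_mul_self.mp (CFC.negPart_nonneg m)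
  refine ⟨m⁻, e, (CFC.negPart_nonneg m).isSelfAdjoint.star_eq, he, ?_, fun h0 => ?_⟩
  · have h := CFC.posPart_sub_negPart m hm
    conv_lhs => enter [1]; rw [← h]
    rw [sub_mul, CFC.posPart_mul_negPart, zero_sub]
  · exact CStarAlgebra.nonneg_iff_eq_star_mul_self.mp ((CFC.negPart_eq_zero_iff m hm).mp h0)

/-- A positive semidefinite matrix over a C*-algebra is a Gram matrix. -/
theorem exists_gram {ι : Type*} [Fintype ι] (t : ι → ι → A)
    (hstar : ∀ i j, star (t i j) = t j i)
    (hpos : ∀ a : ι → A, 0 ≤ ∑ i, ∑ j, star (a i) * t i j * a j) :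
    ∃ c : ι → ι → A, ∀ i j, t i j = ∑ l, star (c l i) * c l j := by
  classical
  let M : CStarMatrix ι ι A := CStarMatrix.ofMatrix (Matrix.of t)
  have hM : IsSelfAdjoint M := by
    ext i j
    simp [M, CStarMatrix.star_apply, hstar]
  have key : ∀ c : CStarMatrix ι ι A, ∀ i, 0 ≤ (star c * M * c) i i := by
    intro c i
    have := hpos (fun j => c j i)
    convert this using 1
    simp only [CStarMatrix.mul_apply, CStarMatrix.star_apply, Finset.sum_mul, M]
    rw [Finset.sum_comm]
    rfl
  obtain ⟨n, e, hsa, he, hn, hc⟩ := exists_negPart M hM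
  have h1 : star n * M * n = - (star (e * n) * (e * n)) := by
    rw [mul_assoc, hn, star_mul, hsa, mul_neg, mul_assoc n (star e), ← mul_assoc (star e), ← he]
  have h2 : e * n = 0 := by
    ext l i
    have hp := key n i
    rw [h1] at hp
    have hs : ∑ l, star ((e * n) l i) * ((e * n) l i) ≤ 0 := by
      have : (star (e * n) * (e * n)) i i ≤ 0 := by
        simpa [CStarMatrix.neg_apply] using hp
      simpa only [CStarMatrix.mul_apply (M := star (e * n)), CStarMatrix.star_apply] using this
    have hz : star ((e * n) l i) * ((e * n) l i) = 0 := by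
      refine le_antisymm ?_ (star_mul_self_nonneg _)
      exact (Finset.single_le_sum (f := fun l => star ((e * n) l i) * ((e * n) l i))
        (fun _ _ => star_mul_self_nonneg _) (Finset.mem_univ l)).trans hs
    simpa using CStarRing.star_mul_self_eq_zero_iff _ |>.mp hz
  have h3 : n * n = 0 := by
    conv_lhs => enter [1]; rw [he]
    rw [mul_assoc, h2, mul_zero]
  have h4 : n = 0 := by
    rw [← CStarRing.star_mul_self_eq_zero_iff, hsa, h3]
  obtain ⟨c, hc⟩ := hc h4
  refine ⟨fun l i => c l i, fun i j => ?_⟩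
  have : M i j = (star c * c) i j := by rw [← hc]
  simpa [CStarMatrix.mul_apply, CStarMatrix.star_apply, M] using this

end Positivity

section HilbertModule

variable {A : Type u} [NonUnitalCStarAlgebra A] [PartialOrder A]

section Basic
variable {E : Type v} [AddCommGroup E] [Module ℂ E] [SMul Aᵐᵒᵖ E] [Norm E] [CStarModule Aᵐᵒᵖ E]

variable (A) in
/-- The `A`-valued inner product of a right Hilbert `A`-module `E`, conjugate linear in the first
and linear in the second variable.

A right `A`-module is a left module over the opposite algebra `Aᵐᵒᵖ`, and `CStarModule Aᵐᵒᵖ E` is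
Mathlib's notion of a (not necessarily complete) Hilbert module for the right action
`x · a = op a • x`; it satisfies `⟨x, y · a⟩ = ⟨x, y⟩ a`, see `ip_smul_right`. -/
def ip (x y : E) : A := unop (inner Aᵐᵒᵖ x y)

theorem ip_smul_right (x y : E) (a : A) : ip A x (op a • y) = ip A x y * a := by
  simp [ip]

theorem ip_smul_left (x y : E) (a : A) : ip A (op a • x) y = star a * ip A x y := by
  simp [ip]

theorem star_ip (x y : E) : star (ip A x y) = ip A y x :=
  congrArg unop (CStarModule.star_inner (A := Aᵐᵒᵖ) x y)

theorem ip_self_nonneg (x : E) : 0 ≤ ip A x x :=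
  CStarModule.inner_self_nonneg (A := Aᵐᵒᵖ) (x := x)

theorem ip_self_eq_zero {x : E} : ip A x x = 0 ↔ x = 0 := by
  rw [ip, unop_eq_zero_iff, CStarModule.inner_self]

variable (A E) in
/-- The inner product of a Hilbert module as a sesquilinear map. -/
def ipₛₗ : E →ₗ⋆[ℂ] E →ₗ[ℂ] A :=
  LinearMap.mk₂'ₛₗ (starRingEnd ℂ) (RingHom.id ℂ) (ip A)
    (fun x y z => by simp [ip]) (fun c x y => by simp [ip])
    (fun x y z => by simp [ip]) (fun c x y => by simp [ip])

@[simp] theorem ipₛₗ_apply (x y : E) : ipₛₗ A E x y = ip A x y := rfl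

theorem ip_sub_right (x y z : E) : ip A x (y - z) = ip A x y - ip A x z :=
  map_sub (ipₛₗ A E x) y z

theorem ip_sub_left (x y z : E) : ip A (x - y) z = ip A x z - ip A y z := by
  simp [ip]

/-- Two elements with the same inner products against everything are equal. -/
theorem ip_ext {x y : E} (h : ∀ z, ip A z x = ip A z y) : x = y := by
  rw [← sub_eq_zero, ← ip_self_eq_zero (A := A), ip_sub_right, h, sub_self]

theorem smul_add_op (a : A) (x y : E) : op a • (x + y) = op a • x + op a • y :=
  ip_ext (A := A) fun z => by
    rw [← ipₛₗ_apply, ← ipₛₗ_apply, map_add]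
    simp only [ipₛₗ_apply, ip_smul_right]
    rw [← ipₛₗ_apply, map_add, add_mul]; rfl

end Basic

variable [StarOrderedRing A]
variable {E : Type v} [AddCommGroup E] [Module ℂ E] [SMul Aᵐᵒᵖ E] [Norm E] [CStarModule Aᵐᵒᵖ E]
variable {H : Type w} [NormedAddCommGroup H] [InnerProductSpace ℂ H] [CompleteSpace H]

/-- The sesquilinear form on the algebraic tensor product `E ⊗ H` given on elementary tensors by
`(ξ ⊗ h, η ⊗ k) ↦ ⟨h, σ (B ξ η) k⟩`. -/
def tform (σ : A →⋆ₙₐ[ℂ] (H →L[ℂ] H)) (B : E →ₗ⋆[ℂ] E →ₗ[ℂ] A) :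
    (E ⊗[ℂ] H) →ₗ⋆[ℂ] (E ⊗[ℂ] H) →ₗ[ℂ] ℂ :=
  TensorProduct.lift <| LinearMap.mk₂'ₛₗ (starRingEnd ℂ) (starRingEnd ℂ)
    (fun ξ h => TensorProduct.lift <| LinearMap.mk₂' ℂ ℂ (fun η k => inner ℂ h (σ (B ξ η) k))
      (fun _ _ _ => by simp) (fun _ _ _ => by simp)
      (fun _ _ _ => by simp) (fun _ _ _ => by simp))
    (fun _ _ _ => TensorProduct.ext' fun _ _ => by simp)
    (fun _ _ _ => TensorProduct.ext' fun _ _ => by simp)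
    (fun _ _ _ => TensorProduct.ext' fun _ _ => by simp)
    (fun _ _ _ => TensorProduct.ext' fun _ _ => by simp [mul_comm])

theorem tform_tmul (σ : A →⋆ₙₐ[ℂ] (H →L[ℂ] H)) (B : E →ₗ⋆[ℂ] E →ₗ[ℂ] A) (ξ η : E) (h k : H) :
    tform σ B (ξ ⊗ₜ h) (η ⊗ₜ k) = inner ℂ h (σ (B ξ η) k) := rfl

/-- Expansion of the diagonal of `tform` along a Gram factorisation. -/
theorem tform_sum_self (σ : A →⋆ₙₐ[ℂ] (H →L[ℂ] H)) (B : E →ₗ⋆[ℂ] E →ₗ[ℂ] A)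
    {ι : Type*} [Fintype ι] (x : ι → E) (h : ι → H) (c : ι → ι → A)
    (hc : ∀ i j, B (x i) (x j) = ∑ l, star (c l i) * c l j) :
    tform σ B (∑ i, x i ⊗ₜ h i) (∑ i, x i ⊗ₜ h i) =
      ((∑ l, ‖∑ j, σ (c l j) (h j)‖ ^ 2 : ℝ) : ℂ) := by
  have h1 : ∀ l, ((‖∑ j, σ (c l j) (h j)‖ ^ 2 : ℝ) : ℂ) =
      ∑ i, ∑ j, inner ℂ (h i) (σ (star (c l i) * c l j) (h j)) := by
    intro l
    have h2 : ∀ y : H, ((‖y‖ ^ 2 : ℝ) : ℂ) = inner ℂ y y := fun y => by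
      rw [inner_self_eq_norm_sq_to_K]; norm_cast
    rw [h2, sum_inner]
    refine Finset.sum_congr rfl fun i _ => ?_
    rw [inner_sum]
    refine Finset.sum_congr rfl fun j _ => ?_
    rw [map_mul, map_star, mul_apply_eq_comp, ContinuousLinearMap.star_eq_adjoint,
      ContinuousLinearMap.adjoint_inner_right]
  rw [Complex.ofReal_sum, Finset.sum_congr rfl fun l _ => h1 l, Finset.sum_comm]
  simp only [map_sum, LinearMap.sum_apply]
  rw [Finset.sum_comm]
  refine Finset.sum_congr rfl fun i _ => ?_
  rw [Finset.sum_comm]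
  refine Finset.sum_congr rfl fun j _ => ?_
  rw [tform_tmul, hc]
  simp

/-- A positive `A`-valued form that is linear over the right action of `A` has Gram
factorisations. -/
theorem exists_gram_form (B : E →ₗ⋆[ℂ] E →ₗ[ℂ] A)
    (hstar : ∀ x y, star (B x y) = B y x) (hsmul : ∀ x y a, B x (op a • y) = B x y * a)
    (hpos : ∀ x, 0 ≤ B x x) {ι : Type*} [Fintype ι] (x : ι → E) :
    ∃ c : ι → ι → A, ∀ i j, B (x i) (x j) = ∑ l, star (c l i) * c l j := by
  refine exists_gram (fun i j => B (x i) (x j)) (fun i j => hstar _ _) fun a => ?_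
  have hl : ∀ x y a, B (op a • x) y = star a * B x y := fun x y a => by
    rw [← hstar, hsmul, star_mul, hstar]
  convert hpos (∑ i, op (a i) • x i) using 1
  simp [map_sum, LinearMap.sum_apply, hsmul, hl, mul_assoc]
  rw [Finset.sum_comm]

theorem exists_tmul_sum (u : E ⊗[ℂ] H) :
    ∃ (ι : Type (max v w)) (_ : Fintype ι) (x : ι → E) (h : ι → H), u = ∑ i, x i ⊗ₜ[ℂ] h i := by
  obtain ⟨S, rfl⟩ := TensorProduct.exists_finset u
  exact ⟨S, inferInstance, fun i => i.1.1, fun i => i.1.2,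
    (Finset.sum_coe_sort S fun i => i.1 ⊗ₜ[ℂ] i.2).symm⟩

theorem tform_self_nonneg (σ : A →⋆ₙₐ[ℂ] (H →L[ℂ] H)) (B : E →ₗ⋆[ℂ] E →ₗ[ℂ] A)
    (hstar : ∀ x y, star (B x y) = B y x) (hsmul : ∀ x y a, B x (op a • y) = B x y * a)
    (hpos : ∀ x, 0 ≤ B x x) (u : E ⊗[ℂ] H) : 0 ≤ (tform σ B u u).re := by
  obtain ⟨ι, _, x, h, rfl⟩ := exists_tmul_sum u
  obtain ⟨c, hc⟩ := exists_gram_form B hstar hsmul hpos x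
  rw [tform_sum_self σ B x h c hc, Complex.ofReal_re]
  positivity

theorem tform_conj_symm (σ : A →⋆ₙₐ[ℂ] (H →L[ℂ] H)) (B : E →ₗ⋆[ℂ] E →ₗ[ℂ] A)
    (hstar : ∀ x y, star (B x y) = B y x) (u v : E ⊗[ℂ] H) :
    starRingEnd ℂ (tform σ B v u) = tform σ B u v := by
  induction u with
  | zero => simp
  | add u₁ u₂ h₁ h₂ => simp [h₁, h₂]
  | tmul ξ h =>
    induction v with
    | zero => simp
    | add v₁ v₂ h₁ h₂ => simp [h₁, h₂]
    | tmul η k =>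
      rw [tform_tmul, tform_tmul, inner_conj_symm, ← hstar, map_star,
        ContinuousLinearMap.star_eq_adjoint, ContinuousLinearMap.adjoint_inner_left]

/-- The algebraic tensor product `E ⊗ H`, carrying the semi-inner product
`⟨ξ ⊗ h, η ⊗ k⟩ = ⟨h, σ(⟨ξ, η⟩) k⟩`. -/
@[nolint unusedArguments]
def PreTensor (E : Type v) [AddCommGroup E] [Module ℂ E] (_σ : A →⋆ₙₐ[ℂ] (H →L[ℂ] H)) :
    Type (max v w) := E ⊗[ℂ] H

section
variable (σ : A →⋆ₙₐ[ℂ] (H →L[ℂ] H))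

instance : AddCommGroup (PreTensor E σ) := inferInstanceAs (AddCommGroup (E ⊗[ℂ] H))
instance : Module ℂ (PreTensor E σ) := inferInstanceAs (Module ℂ (E ⊗[ℂ] H))

/-- The identity map from `E ⊗ H` to the type synonym `PreTensor`. -/
def PreTensor.of : E ⊗[ℂ] H ≃ₗ[ℂ] PreTensor E σ := LinearEquiv.refl ℂ (E ⊗[ℂ] H)

variable (E) in
/-- The semi-inner product on the algebraic tensor product. -/
@[reducible] def PreTensor.core : PreInnerProductSpace.Core ℂ (PreTensor E σ) where
  inner u v := tform σ (ipₛₗ A E) ((PreTensor.of σ).symm u) ((PreTensor.of σ).symm v)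
  conj_inner_symm u v := tform_conj_symm σ _ star_ip u v
  re_inner_nonneg u := tform_self_nonneg σ _ star_ip ip_smul_right ip_self_nonneg u
  add_left u v w := by simp
  smul_left u v c := by simp

instance : SeminormedAddCommGroup (PreTensor E σ) :=
  @InnerProductSpace.Core.toSeminormedAddCommGroup ℂ (PreTensor E σ) _ _ _ (PreTensor.core E σ)

instance : InnerProductSpace ℂ (PreTensor E σ) := InnerProductSpace.ofCore (PreTensor.core E σ)

variable (E) in
/-- The internal tensor product `E ⊗_σ H` of a Hilbert `A`-module `E` with a representation
`σ` of `A` on a Hilbert space `H`: the Hilbert space obtained from `E ⊗ H` with the semi-inner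
product `⟨ξ ⊗ h, η ⊗ k⟩ = ⟨h, σ(⟨ξ, η⟩) k⟩` by separation and completion. -/
abbrev IntTensor : Type (max v w) := UniformSpace.Completion (PreTensor E σ)

/-- The elementary tensor `ξ ⊗ h` in `E ⊗_σ H`. -/
def tm (ξ : E) (h : H) : IntTensor E σ := (PreTensor.of σ (ξ ⊗ₜ[ℂ] h) : PreTensor E σ)

theorem PreTensor.inner_of (u v : E ⊗[ℂ] H) :
    inner ℂ (PreTensor.of σ u) (PreTensor.of σ v) = tform σ (ipₛₗ A E) u v := rfl

theorem inner_tm (ξ η : E) (h k : H) :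
    inner ℂ (tm σ ξ h) (tm σ η k) = inner ℂ h (σ (ip A ξ η) k) := by
  rw [tm, tm, UniformSpace.Completion.inner_coe, PreTensor.inner_of, tform_tmul]; rfl

theorem PreTensor.norm_sq (u : E ⊗[ℂ] H) :
    ‖PreTensor.of σ u‖ ^ 2 = (tform σ (ipₛₗ A E) u u).re := by
  rw [← PreTensor.inner_of]
  exact norm_sq_eq_re_inner (𝕜 := ℂ) _

/-- Continuous linear maps on `E ⊗_σ H` are determined by their values on elementary tensors. -/
theorem intTensor_ext {G : Type*} [NormedAddCommGroup G] [NormedSpace ℂ G]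
    {f g : IntTensor E σ →L[ℂ] G} (hfg : ∀ ξ h, f (tm σ ξ h) = g (tm σ ξ h)) : f = g := by
  ext u
  induction u using UniformSpace.Completion.induction_on with
  | hp => exact isClosed_eq f.continuous g.continuous
  | ih u =>
    obtain ⟨u, rfl⟩ := (PreTensor.of σ).surjective u
    induction u with
    | zero => rw [map_zero, UniformSpace.Completion.coe_zero, map_zero, map_zero]
    | add u v hu hv => rw [map_add, UniformSpace.Completion.coe_add, map_add, map_add, hu, hv]
    | tmul ξ h => exact hfg ξ h

/-- Extension by continuity of a linear map from the algebraic tensor product. -/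
def liftL {G : Type*} [NormedAddCommGroup G] [NormedSpace ℂ G] [CompleteSpace G]
    (f : E ⊗[ℂ] H →ₗ[ℂ] G) (C : ℝ)
    (hf : ∀ u, ‖f u‖ ^ 2 ≤ C ^ 2 * (tform σ (ipₛₗ A E) u u).re) : IntTensor E σ →L[ℂ] G :=
  ContinuousLinearMap.fromCompletion
    (LinearMap.mkContinuous (f ∘ₗ (PreTensor.of σ).symm.toLinearMap) |C| fun u => by
      obtain ⟨u, rfl⟩ := (PreTensor.of σ).surjective u
      have h := hf u
      rw [← PreTensor.norm_sq σ u, ← mul_pow, sq_le_sq, abs_norm, abs_mul, abs_norm] at h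
      simpa using h)

theorem liftL_tm {G : Type*} [NormedAddCommGroup G] [NormedSpace ℂ G] [CompleteSpace G]
    (f : E ⊗[ℂ] H →ₗ[ℂ] G) (C : ℝ)
    (hf : ∀ u, ‖f u‖ ^ 2 ≤ C ^ 2 * (tform σ (ipₛₗ A E) u u).re) (ξ : E) (h : H) :
    liftL σ f C hf (tm σ ξ h) = f (ξ ⊗ₜ h) :=
  (ContinuousLinearMap.fromCompletion_apply_coe _ _).trans (by simp)

end
end HilbertModule

section Operators

variable {A : Type u} [NonUnitalCStarAlgebra A] [PartialOrder A] [StarOrderedRing A]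
variable {E : Type v} [AddCommGroup E] [Module ℂ E] [SMul Aᵐᵒᵖ E] [Norm E] [CStarModule Aᵐᵒᵖ E]
variable {F : Type*} [AddCommGroup F] [Module ℂ F] [SMul Aᵐᵒᵖ F] [Norm F] [CStarModule Aᵐᵒᵖ F]
variable {H : Type w} [NormedAddCommGroup H] [InnerProductSpace ℂ H] [CompleteSpace H]
variable {K : Type*} [NormedAddCommGroup K] [InnerProductSpace ℂ K] [CompleteSpace K]

theorem norm_coe_sq (σ : A →⋆ₙₐ[ℂ] (H →L[ℂ] H)) (u : E ⊗[ℂ] H) :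
    ‖((PreTensor.of σ u : PreTensor E σ) : IntTensor E σ)‖ ^ 2 = (tform σ (ipₛₗ A E) u u).re := by
  rw [UniformSpace.Completion.norm_coe, PreTensor.norm_sq]

variable (σ : A →⋆ₙₐ[ℂ] (H →L[ℂ] H)) (ρ : A →⋆ₙₐ[ℂ] (K →L[ℂ] K))

theorem ampL_bound (S : E →ₗ[ℂ] F) (C : ℝ) (hS : ∀ x (a : A), S (op a • x) = op a • S x)
    (hC : ∀ x, ip A (S x) (S x) ≤ (C ^ 2) • ip A x x) (u : E ⊗[ℂ] H) :
    ‖((PreTensor.of σ (S.rTensor H u) : PreTensor F σ) : IntTensor F σ)‖ ^ 2 ≤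
      C ^ 2 * (tform σ (ipₛₗ A E) u u).re := by
  let B : E →ₗ⋆[ℂ] E →ₗ[ℂ] A := LinearMap.mk₂'ₛₗ (starRingEnd ℂ) (RingHom.id ℂ)
    (fun x y => ((C ^ 2 : ℝ) : ℂ) • ipₛₗ A E x y - ipₛₗ A F (S x) (S y))
    (fun x y z => by simp only [map_add, LinearMap.add_apply, smul_add]; abel)
    (fun c x y => by
      simp only [map_smul, LinearMap.map_smulₛₗ, LinearMap.smul_apply, smul_sub]
      rw [smul_comm])
    (fun x y z => by simp only [map_add, smul_add]; abel)
    (fun c x y => by simp only [map_smul, smul_sub, RingHom.id_apply]; rw [smul_comm])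
  have hB : ∀ x y, B x y = ((C ^ 2 : ℝ) : ℂ) • ip A x y - ip A (S x) (S y) := fun _ _ => rfl
  have h1 : ∀ u v : E ⊗[ℂ] H, tform σ B u v = ((C ^ 2 : ℝ) : ℂ) * tform σ (ipₛₗ A E) u v -
      tform σ (ipₛₗ A F) (S.rTensor H u) (S.rTensor H v) := by
    intro u v
    induction u with
    | zero => simp
    | add u₁ u₂ h₁ h₂ => simp only [map_add, LinearMap.add_apply, h₁, h₂]; ring
    | tmul ξ h =>
      induction v with
      | zero => simp
      | add v₁ v₂ h₁ h₂ => simp only [map_add, h₁, h₂]; ring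
      | tmul η k =>
        rw [LinearMap.rTensor_tmul, LinearMap.rTensor_tmul, tform_tmul, tform_tmul, tform_tmul, hB,
          map_sub, map_smul, sub_apply, inner_sub_right,
          smul_apply, inner_smul_right]
        rfl
  have h2 := tform_self_nonneg σ B
    (fun x y => by rw [hB, hB, star_sub, star_smul, star_ip, star_ip]; simp)
    (fun x y a => by rw [hB, hB, hS, ip_smul_right, ip_smul_right, sub_mul, smul_mul_assoc])
    (fun x => by
      rw [hB, sub_nonneg]
      have := hC x
      rwa [← Complex.coe_smul] at this) u
  rw [h1, Complex.sub_re, Complex.re_ofReal_mul] at h2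
  rw [norm_coe_sq]
  linarith

/-- For an `A`-linear map `S : E → F` of Hilbert modules that is bounded, in the form
`⟨S x, S x⟩ ≤ C² ⟨x, x⟩`, the operator `S ⊗ I_H : E ⊗_σ H → F ⊗_σ H`. -/
def ampL (S : E →ₗ[ℂ] F) (C : ℝ) (hS : ∀ x (a : A), S (op a • x) = op a • S x)
    (hC : ∀ x, ip A (S x) (S x) ≤ (C ^ 2) • ip A x x) : IntTensor E σ →L[ℂ] IntTensor F σ :=
  liftL σ ((UniformSpace.Completion.toComplₗᵢ (𝕜 := ℂ) (E := PreTensor F σ)).toLinearMap ∘ₗ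
    (PreTensor.of σ).toLinearMap ∘ₗ S.rTensor H) C (ampL_bound σ S C hS hC)

@[simp] theorem ampL_tm (S : E →ₗ[ℂ] F) (C : ℝ) (hS : ∀ x (a : A), S (op a • x) = op a • S x)
    (hC : ∀ x, ip A (S x) (S x) ≤ (C ^ 2) • ip A x x) (ξ : E) (h : H) :
    ampL σ S C hS hC (tm σ ξ h) = tm σ (S ξ) h :=
  liftL_tm _ _ _ _ _ _

theorem ampR_bound (V : H →L[ℂ] K) (hV : ∀ a h, V (σ a h) = ρ a (V h)) (u : E ⊗[ℂ] H) :
    ‖((PreTensor.of ρ (V.toLinearMap.lTensor E u) : PreTensor E ρ) : IntTensor E ρ)‖ ^ 2 ≤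
      ‖V‖ ^ 2 * (tform σ (ipₛₗ A E) u u).re := by
  rw [norm_coe_sq]
  obtain ⟨ι, _, x, h, rfl⟩ := exists_tmul_sum u
  obtain ⟨c, hc⟩ := exists_gram_form (ipₛₗ A E) star_ip ip_smul_right ip_self_nonneg x
  rw [map_sum]
  simp only [LinearMap.lTensor_tmul]
  rw [tform_sum_self σ _ x h c hc, tform_sum_self ρ _ x _ c hc, Complex.ofReal_re,
    Complex.ofReal_re, Finset.mul_sum]
  refine Finset.sum_le_sum fun l _ => ?_
  rw [← mul_pow]
  refine pow_le_pow_left₀ (norm_nonneg _) ?_ 2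
  have : ∑ j, ρ (c l j) (V.toLinearMap (h j)) = V (∑ j, σ (c l j) (h j)) := by
    rw [map_sum]
    exact Finset.sum_congr rfl fun j _ => (hV _ _).symm
  rw [this]
  exact V.le_opNorm _

variable (E) in
/-- For a bounded operator `V : H → K` intertwining the representations `σ` and `ρ` of `A`, the
operator `I_E ⊗ V : E ⊗_σ H → E ⊗_ρ K`. -/
def ampR (V : H →L[ℂ] K) (hV : ∀ a h, V (σ a h) = ρ a (V h)) :
    IntTensor E σ →L[ℂ] IntTensor E ρ :=
  liftL σ ((UniformSpace.Completion.toComplₗᵢ (𝕜 := ℂ) (E := PreTensor E ρ)).toLinearMap ∘ₗ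
    (PreTensor.of ρ).toLinearMap ∘ₗ V.toLinearMap.lTensor E) ‖V‖ (ampR_bound σ ρ V hV)

@[simp] theorem ampR_tm (V : H →L[ℂ] K) (hV : ∀ a h, V (σ a h) = ρ a (V h)) (ξ : E) (h : H) :
    ampR E σ ρ V hV (tm σ ξ h) = tm ρ ξ (V h) :=
  liftL_tm _ _ _ _ _ _

theorem inner_lift (T : E →ₗ[ℂ] (H →L[ℂ] K))
    (hT : ∀ ξ η h k, inner ℂ (T ξ h) (T η k) = inner ℂ h (σ (ip A ξ η) k)) (u v : E ⊗[ℂ] H) :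
    inner ℂ (TensorProduct.lift ((ContinuousLinearMap.coeLM ℂ).comp T) u)
      (TensorProduct.lift ((ContinuousLinearMap.coeLM ℂ).comp T) v) =
      tform σ (ipₛₗ A E) u v := by
  induction u with
  | zero => simp
  | add u₁ u₂ h₁ h₂ => simp only [map_add, LinearMap.add_apply, inner_add_left, h₁, h₂]
  | tmul ξ h =>
    induction v with
    | zero => simp
    | add v₁ v₂ h₁ h₂ => simp only [map_add, inner_add_right, h₁, h₂]
    | tmul η k => exact hT ξ η h k

theorem norm_lift_sq (T : E →ₗ[ℂ] (H →L[ℂ] K))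
    (hT : ∀ ξ η h k, inner ℂ (T ξ h) (T η k) = inner ℂ h (σ (ip A ξ η) k)) (u : E ⊗[ℂ] H) :
    ‖TensorProduct.lift ((ContinuousLinearMap.coeLM ℂ).comp T) u‖ ^ 2 =
      (tform σ (ipₛₗ A E) u u).re := by
  rw [← inner_lift σ T hT]; exact norm_sq_eq_re_inner (𝕜 := ℂ) _

/-- The bounded operator underlying `liftIsometry`. -/
def liftIsometryAux (T : E →ₗ[ℂ] (H →L[ℂ] K))
    (hT : ∀ ξ η h k, inner ℂ (T ξ h) (T η k) = inner ℂ h (σ (ip A ξ η) k)) :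
    IntTensor E σ →L[ℂ] K :=
  liftL σ (TensorProduct.lift ((ContinuousLinearMap.coeLM ℂ).comp T)) 1
    (fun u => by rw [norm_lift_sq σ T hT]; simp)

/-- A linear map `T : E → B(H, K)` with `T(ξ)^* T(η) = σ(⟨ξ, η⟩)` determines an isometry
`E ⊗_σ H → K`, `ξ ⊗ h ↦ T(ξ) h`. -/
def liftIsometry (T : E →ₗ[ℂ] (H →L[ℂ] K))
    (hT : ∀ ξ η h k, inner ℂ (T ξ h) (T η k) = inner ℂ h (σ (ip A ξ η) k)) :
    IntTensor E σ →ₗᵢ[ℂ] K where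
  toLinearMap := (liftIsometryAux σ T hT).toLinearMap
  norm_map' u := by
    induction u using UniformSpace.Completion.induction_on with
    | hp => exact isClosed_eq (liftIsometryAux σ T hT).continuous.norm continuous_norm
    | ih u =>
      obtain ⟨u, rfl⟩ := (PreTensor.of σ).surjective u
      have h3 : liftIsometryAux σ T hT ((PreTensor.of σ u : PreTensor E σ) : IntTensor E σ) =
          TensorProduct.lift ((ContinuousLinearMap.coeLM ℂ).comp T) u :=
        (ContinuousLinearMap.fromCompletion_apply_coe _ _).trans (by simp)
      have h4 := (norm_lift_sq σ T hT u).trans (norm_coe_sq σ u).symm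
      rw [← h3] at h4
      exact (pow_left_inj₀ (norm_nonneg _) (norm_nonneg _) two_ne_zero).mp h4

@[simp] theorem liftIsometry_tm (T : E →ₗ[ℂ] (H →L[ℂ] K))
    (hT : ∀ ξ η h k, inner ℂ (T ξ h) (T η k) = inner ℂ h (σ (ip A ξ η) k)) (ξ : E) (h : H) :
    liftIsometry σ T hT (tm σ ξ h) = T ξ h :=
  (liftL_tm _ _ _ (fun u => by rw [norm_lift_sq σ T hT]; simp) _ _ : _)

end Operators

section Correspondences

variable {A : Type u} [NonUnitalCStarAlgebra A] [PartialOrder A] [StarOrderedRing A]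

/-- A left action of `A` on a Hilbert `A`-module `E` by adjointable operators, given by a
*-homomorphism `φ`: `φ(ab) = φ(a)φ(b)` and `φ(a)` has the adjoint `φ(a^*)`. (A map with an adjoint
is automatically bounded and linear over the right action of `A`.) -/
class LeftAction (A : Type u) (E : Type v) [NonUnitalCStarAlgebra A] [PartialOrder A]
    [AddCommGroup E] [Module ℂ E] [SMul Aᵐᵒᵖ E] [Norm E] [CStarModule Aᵐᵒᵖ E] where
  /-- The left action `φ`. -/
  lact : A →ₙₐ[ℂ] Module.End ℂ E
  ip_lact : ∀ (a : A) (x y : E), ip A (lact a x) y = ip A x (lact (star a) y)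

open LeftAction

/-- A C*-correspondence over `A`: a (complete) right Hilbert `A`-module `E` with a left action of
`A` by adjointable operators, which is essential: `φ(A)E` spans a dense subspace of `E`. -/
class Correspondence (A : Type u) (E : Type v) [NonUnitalCStarAlgebra A] [PartialOrder A]
    [NormedAddCommGroup E] [NormedSpace ℂ E] [SMul Aᵐᵒᵖ E] [CStarModule Aᵐᵒᵖ E]
    extends LeftAction A E, CompleteSpace E where
  essential : (Submodule.span ℂ {z : E | ∃ (a : A) (x : E), lact a x = z}).topologicalClosure = ⊤

section
variable {E : Type v} [AddCommGroup E] [Module ℂ E] [SMul Aᵐᵒᵖ E] [Norm E] [CStarModule Aᵐᵒᵖ E]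

theorem norm_ip_self (x : E) : ‖ip A x x‖ = ‖x‖ ^ 2 := by
  rw [CStarModule.norm_sq_eq Aᵐᵒᵖ, ip, norm_unop]

variable [LeftAction A E]

theorem lact_smul (a b : A) (x : E) : lact a (op b • x) = op b • lact a x :=
  ip_ext (A := A) fun z => by
    have h : ∀ y : E, ip A z (lact a y) = ip A (lact (star a) z) y := fun y => by
      rw [ip_lact, star_star]
    rw [h, ip_smul_right, ip_smul_right, h]

theorem exists_sub_sq (a : A) : ∃ d : A, star d = d ∧
    (2 * ‖a‖ : ℝ) • d - d * d = star a * a := by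
  set s : ℝ := ‖a‖ with hs
  let f : ℝ → ℝ := fun t => s - √(s ^ 2 - t)
  have hf0 : f 0 = 0 := by simp [f, hs]
  have hfc : Continuous f := by fun_prop
  have hsa : IsSelfAdjoint (star a * a) := IsSelfAdjoint.star_mul_self a
  refine ⟨cfcₙ f (star a * a), (cfcₙ_predicate f (star a * a)).star_eq, ?_⟩
  rw [← cfcₙ_smul (2 * s) f (star a * a) hfc.continuousOn hf0,
    ← cfcₙ_mul f f (star a * a) hfc.continuousOn hf0 hfc.continuousOn hf0,
    ← cfcₙ_sub _ _ (star a * a) (by fun_prop) (by simp [hf0]) (by fun_prop) (by simp [hf0])]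
  conv_rhs => rw [← cfcₙ_id ℝ (star a * a)]
  refine cfcₙ_congr fun t ht => ?_
  have h1 : t ≤ s ^ 2 := by
    have := NonUnitalIsometricContinuousFunctionalCalculus.norm_quasispectrum_le _ ht hsa
    rw [CStarRing.norm_star_mul_self, ← sq] at this
    exact (le_abs_self t).trans this
  have h2 := Real.sq_sqrt (sub_nonneg.mpr h1)
  simp only [f, smul_eq_mul, id]
  nlinarith

/-- The left action is contractive: `⟨φ(a) x, φ(a) x⟩ ≤ ‖a‖² ⟨x, x⟩`. -/
theorem lact_bound (a : A) (x : E) : ip A (lact a x) (lact a x) ≤ (‖a‖ ^ 2) • ip A x x := by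
  obtain ⟨d, hd, h⟩ := exists_sub_sq a
  have h1 : (‖a‖ ^ 2) • ip A x x - ip A (lact a x) (lact a x) =
      ip A ((‖a‖ : ℂ) • x - lact d x) ((‖a‖ : ℂ) • x - lact d x) := by
    have e1 : ip A (lact a x) (lact a x) = ip A x (lact (star a * a) x) := by
      rw [ip_lact, map_mul]; rfl
    have e2 : ip A (lact d x) (lact d x) = ip A x (lact (d * d) x) := by
      rw [ip_lact, map_mul, hd]; rfl
    have e3 : ip A (lact d x) x = ip A x (lact d x) := by rw [ip_lact, hd]
    have e4 : lact (star a * a) x = ((2 * ‖a‖ : ℝ) : ℂ) • lact d x - lact (d * d) x := by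
      rw [← h, map_sub, ← Complex.coe_smul, map_smul]; rfl
    have r1 : ∀ (c : ℝ) (y z : E), ip A y ((c : ℂ) • z) = (c : ℂ) • ip A y z := fun c y z =>
      map_smul (ipₛₗ A E y) _ _
    have r2 : ∀ (c : ℝ) (y z : E), ip A ((c : ℂ) • y) z = (c : ℂ) • ip A y z := fun c y z => by
      rw [← star_ip, r1, star_smul, star_ip]; simp
    rw [e1, e4]
    simp only [ip_sub_right, ip_sub_left, r1, r2, e2, e3]
    simp only [Complex.coe_smul]
    module
  exact sub_nonneg.mp (h1 ▸ ip_self_nonneg _)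

end
end Correspondences

open LeftAction

section LeftRep

variable {A : Type u} [NonUnitalCStarAlgebra A] [PartialOrder A] [StarOrderedRing A]
variable {E : Type v} [AddCommGroup E] [Module ℂ E] [SMul Aᵐᵒᵖ E] [Norm E] [CStarModule Aᵐᵒᵖ E]
variable {H : Type w} [NormedAddCommGroup H] [InnerProductSpace ℂ H] [CompleteSpace H]
variable (σ : A →⋆ₙₐ[ℂ] (H →L[ℂ] H))

theorem norm_tm_le (ξ : E) (h : H) : ‖tm σ ξ h‖ ≤ ‖ξ‖ * ‖h‖ := by
  have h1 : ‖tm σ ξ h‖ ^ 2 ≤ (‖ξ‖ * ‖h‖) ^ 2 := by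
    have e : ‖tm σ ξ h‖ ^ 2 = (inner ℂ h (σ (ip A ξ ξ) h)).re := by
      rw [← inner_tm]; exact norm_sq_eq_re_inner (𝕜 := ℂ) _
    rw [e]
    calc (inner ℂ h (σ (ip A ξ ξ) h)).re ≤ ‖inner ℂ h (σ (ip A ξ ξ) h)‖ := Complex.re_le_norm _
      _ ≤ ‖h‖ * ‖σ (ip A ξ ξ) h‖ := norm_inner_le_norm _ _
      _ ≤ ‖h‖ * (‖ip A ξ ξ‖ * ‖h‖) := by
          gcongr
          exact ((σ (ip A ξ ξ)).le_opNorm h).trans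
            (by gcongr; exact NonUnitalStarAlgHom.norm_apply_le σ _)
      _ = (‖ξ‖ * ‖h‖) ^ 2 := by rw [norm_ip_self]; ring
  exact (pow_le_pow_iff_left₀ (norm_nonneg _) (mul_nonneg (CStarModule.norm_nonneg Aᵐᵒᵖ) (norm_nonneg _))
    two_ne_zero).mp h1

theorem tm_add_left (ξ η : E) (h : H) : tm σ (ξ + η) h = tm σ ξ h + tm σ η h := by
  rw [tm, tm, tm, TensorProduct.add_tmul, map_add, UniformSpace.Completion.coe_add]

theorem tm_smul_left (c : ℂ) (ξ : E) (h : H) : tm σ (c • ξ) h = c • tm σ ξ h := by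
  rw [tm, tm, ← TensorProduct.smul_tmul', map_smul, UniformSpace.Completion.coe_smul]

theorem tm_add_right (ξ : E) (h k : H) : tm σ ξ (h + k) = tm σ ξ h + tm σ ξ k := by
  rw [tm, tm, tm, TensorProduct.tmul_add, map_add, UniformSpace.Completion.coe_add]

theorem topologicalClosure_span_tm :
    (Submodule.span ℂ {z : IntTensor E σ | ∃ ξ h, tm σ ξ h = z}).topologicalClosure = ⊤ := by
  rw [← Submodule.dense_iff_topologicalClosure_eq_top]
  refine (UniformSpace.Completion.denseRange_coe (α := PreTensor E σ)).mono ?_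
  rintro _ ⟨u, rfl⟩
  obtain ⟨u, rfl⟩ := (PreTensor.of σ).surjective u
  rw [SetLike.mem_coe]
  induction u with
  | zero => rw [map_zero, UniformSpace.Completion.coe_zero]; exact zero_mem _
  | add u v hu hv => rw [map_add, UniformSpace.Completion.coe_add]; exact add_mem hu hv
  | tmul ξ h => exact Submodule.subset_span ⟨ξ, h, rfl⟩

/-- Operators on `E ⊗_σ H` that are adjoint to each other on elementary tensors are adjoint. -/
theorem eq_adjoint_of_tm {f g : IntTensor E σ →L[ℂ] IntTensor E σ}
    (hfg : ∀ (ξ η : E) (h k : H),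
      inner ℂ (f (tm σ ξ h)) (tm σ η k) = inner ℂ (tm σ ξ h) (g (tm σ η k))) :
    g = ContinuousLinearMap.adjoint f := by
  refine intTensor_ext σ fun η k => ext_inner_left ℂ fun z => ?_
  rw [ContinuousLinearMap.adjoint_inner_right]
  have : (innerSL ℂ (tm σ η k)).comp f = innerSL ℂ (g (tm σ η k)) :=
    intTensor_ext σ fun ξ h => by
      simp only [ContinuousLinearMap.comp_apply, innerSL_apply_apply]
      rw [← inner_conj_symm, hfg, inner_conj_symm]
  have h2 := congrArg (fun F => F z) this
  simp only [ContinuousLinearMap.comp_apply, innerSL_apply_apply] at h2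
  rw [← inner_conj_symm, ← h2, inner_conj_symm]

end LeftRep

section LeftRep

variable {A : Type u} [NonUnitalCStarAlgebra A] [PartialOrder A] [StarOrderedRing A]
variable {E : Type v} [AddCommGroup E] [Module ℂ E] [SMul Aᵐᵒᵖ E] [Norm E] [CStarModule Aᵐᵒᵖ E]
variable [LeftAction A E]
variable {H : Type w} [NormedAddCommGroup H] [InnerProductSpace ℂ H] [CompleteSpace H]
variable (σ : A →⋆ₙₐ[ℂ] (H →L[ℂ] H))

variable (E) in
/-- The representation `a ↦ φ(a) ⊗ I_H` of `A` on `E ⊗_σ H`. -/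
def leftRep : A →⋆ₙₐ[ℂ] (IntTensor E σ →L[ℂ] IntTensor E σ) where
  toFun a := ampL σ (lact a) ‖a‖ (fun x b => lact_smul a b x)
    (lact_bound a)
  map_smul' c a := intTensor_ext σ fun ξ h => by simp [tm_smul_left]
  map_zero' := intTensor_ext σ fun ξ h => by
    simpa using tm_smul_left σ 0 (0 : E) h
  map_add' a b := intTensor_ext σ fun ξ h => by simp [tm_add_left]
  map_mul' a b := intTensor_ext σ fun ξ h => by simp
  map_star' a := eq_adjoint_of_tm σ fun ξ η h k => by
    simp only [ampL_tm, inner_tm]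
    rw [ip_lact]

@[simp] theorem leftRep_tm (a : A) (ξ : E) (h : H) :
    leftRep E σ a (tm σ ξ h) = tm σ (lact a ξ) h := 
  ampL_tm σ _ _ (fun x b => lact_smul a b x) (lact_bound a) _ _

end LeftRep

section
variable {A : Type u} [NonUnitalCStarAlgebra A] [PartialOrder A] [StarOrderedRing A]
variable {E : Type v} [NormedAddCommGroup E] [NormedSpace ℂ E] [SMul Aᵐᵒᵖ E] [CStarModule Aᵐᵒᵖ E]
variable {H : Type w} [NormedAddCommGroup H] [InnerProductSpace ℂ H] [CompleteSpace H]
variable (σ : A →⋆ₙₐ[ℂ] (H →L[ℂ] H))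

/-- The bounded linear map `ξ ↦ ξ ⊗ h`. -/
def tmL (h : H) : E →L[ℂ] IntTensor E σ :=
  LinearMap.mkContinuous ⟨⟨fun ξ => tm σ ξ h, fun _ _ => tm_add_left σ _ _ h⟩,
    fun c ξ => tm_smul_left σ c ξ h⟩ ‖h‖ fun ξ => by
      rw [mul_comm]; exact norm_tm_le σ ξ h

@[simp] theorem tmL_apply (h : H) (ξ : E) : tmL σ h ξ = tm σ ξ h := rfl

end

section ProductSystems

variable {A : Type u} [NonUnitalCStarAlgebra A] [PartialOrder A] [StarOrderedRing A]
variable {k : ℕ}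

/-- A product system over `ℕ₀^k` of C*-correspondences over `A`: a family `E n`, `n ∈ ℕ₀^k`, with
`E 0 = A` and an associative multiplication `E m × E n → E (m + n)` inducing isomorphisms of
correspondences `E m ⊗_A E n ≅ E (m + n)` and given by the left and right action of `A` if
`m = 0` or `n = 0`.

That the multiplication induces an isomorphism from the internal tensor product is expressed by
`mul_lact`, `mul_smul` (bimodule map), `ip_mul` (isometric for the inner product
`⟨x ⊗ y, x' ⊗ y'⟩ = ⟨y, φ(⟨x, x'⟩) y'⟩` of `E m ⊗_A E n`) and `dense_mul` (dense range). The index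
`p` and the hypothesis `m + n = p` stand for `p = m + n`, so that no transport between the types
`E ((l + m) + n)` and `E (l + (m + n))` is needed. -/
structure ProductSystem (A : Type u) [NonUnitalCStarAlgebra A] [PartialOrder A] {k : ℕ}
    (E : (Fin k → ℕ) → Type v) [∀ n, NormedAddCommGroup (E n)] [∀ n, NormedSpace ℂ (E n)]
    [∀ n, SMul Aᵐᵒᵖ (E n)] [∀ n, CStarModule Aᵐᵒᵖ (E n)] [∀ n, Correspondence A (E n)] where
  /-- The multiplication of the product system. -/
  mul : ∀ {m n p : Fin k → ℕ}, m + n = p → E m →ₗ[ℂ] E n →ₗ[ℂ] E p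
  mul_lact : ∀ {m n p : Fin k → ℕ} (h : m + n = p) (a : A) (x : E m) (y : E n),
    mul h (lact a x) y = lact a (mul h x y)
  mul_smul : ∀ {m n p : Fin k → ℕ} (h : m + n = p) (a : A) (x : E m) (y : E n),
    mul h x (op a • y) = op a • mul h x y
  ip_mul : ∀ {m n p : Fin k → ℕ} (h : m + n = p) (x x' : E m) (y y' : E n),
    ip A (mul h x y) (mul h x' y') = ip A y (lact (ip A x x') y')
  dense_mul : ∀ {m n p : Fin k → ℕ} (h : m + n = p),
    (Submodule.span ℂ {z : E p | ∃ x y, mul h x y = z}).topologicalClosure = ⊤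
  mul_assoc : ∀ {l m n lm mn p : Fin k → ℕ} (h₁ : l + m = lm) (h₂ : lm + n = p) (h₃ : m + n = mn)
    (h₄ : l + mn = p) (x : E l) (y : E m) (z : E n),
    mul h₂ (mul h₁ x y) z = mul h₄ x (mul h₃ y z)
  /-- The identification of the correspondence `A` with `E 0`. -/
  unit : A ≃ₗ[ℂ] E 0
  ip_unit : ∀ a b, ip A (unit a) (unit b) = star a * b
  lact_unit : ∀ a b, lact a (unit b) = unit (a * b)
  smul_unit : ∀ a b : A, op b • unit a = unit (a * b)
  unit_mul : ∀ {n : Fin k → ℕ} (a : A) (x : E n), mul (zero_add n) (unit a) x = lact a x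
  mul_unit : ∀ {n : Fin k → ℕ} (a : A) (x : E n), mul (add_zero n) x (unit a) = op a • x

/-- The `i`-th basis element of `ℕ₀^k`. -/
abbrev ε (i : Fin k) : Fin k → ℕ := Pi.single i 1

variable {E : (Fin k → ℕ) → Type v} [∀ n, NormedAddCommGroup (E n)] [∀ n, NormedSpace ℂ (E n)]
    [∀ n, SMul Aᵐᵒᵖ (E n)] [∀ n, CStarModule Aᵐᵒᵖ (E n)] [∀ n, Correspondence A (E n)]
variable {H : Type w} [NormedAddCommGroup H] [InnerProductSpace ℂ H] [CompleteSpace H]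

namespace ProductSystem

variable (X : ProductSystem A E)

theorem mul_bound {m n p : Fin k → ℕ} (h : m + n = p) (x : E m) (y : E n) :
    ip A (X.mul h x y) (X.mul h x y) ≤ (‖x‖ ^ 2) • ip A y y := by
  obtain ⟨b, hb⟩ := CStarAlgebra.nonneg_iff_eq_star_mul_self.mp (ip_self_nonneg (A := A) x)
  have h1 : ip A y (lact (star b * b) y) = ip A (lact b y) (lact b y) := by
    rw [ip_lact, map_mul]; rfl
  have h2 : ‖x‖ ^ 2 = ‖b‖ ^ 2 := by
    rw [← norm_ip_self (A := A), hb, CStarRing.norm_star_mul_self, sq]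
  rw [X.ip_mul, hb, h1, h2]
  exact lact_bound b y

variable (σ : A →⋆ₙₐ[ℂ] (H →L[ℂ] H))

/-- The map `x ↦ (y ⊗ h ↦ xy ⊗ h)` from `E m` to the operators `E n ⊗_σ H → E p ⊗_σ H`,
`p = m + n`. -/
def mulOp {m n p : Fin k → ℕ} (h : m + n = p) :
    E m →ₗ[ℂ] (IntTensor (E n) σ →L[ℂ] IntTensor (E p) σ) where
  toFun x := ampL σ (X.mul h x) ‖x‖ (fun y a => X.mul_smul h a x y) (X.mul_bound h x)
  map_add' x x' := intTensor_ext σ fun y z => by simp [tm_add_left]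
  map_smul' c x := intTensor_ext σ fun y z => by simp [tm_smul_left]

@[simp] theorem mulOp_tm {m n p : Fin k → ℕ} (h : m + n = p) (x : E m) (y : E n) (z : H) :
    X.mulOp σ h x (tm σ y z) = tm σ (X.mul h x y) z :=
  ampL_tm σ _ _ (fun y a => X.mul_smul h a x y) (X.mul_bound h x) _ _

theorem inner_mulOp {m n p : Fin k → ℕ} (h : m + n = p) (x x' : E m)
    (u u' : IntTensor (E n) σ) :
    inner ℂ (X.mulOp σ h x u) (X.mulOp σ h x' u') =
      inner ℂ u (leftRep (E n) σ (ip A x x') u') := by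
  have h1 : ∀ (y : E n) (z : H), (innerSL ℂ (X.mulOp σ h x (tm σ y z))).comp (X.mulOp σ h x') =
      (innerSL ℂ (tm σ y z)).comp (leftRep (E n) σ (ip A x x')) := fun y z =>
    intTensor_ext σ fun y' z' => by
      simp only [ContinuousLinearMap.comp_apply, innerSL_apply_apply, mulOp_tm, inner_tm,
        leftRep_tm, X.ip_mul]
  have h2 : (innerSL ℂ (X.mulOp σ h x' u')).comp (X.mulOp σ h x) =
      innerSL ℂ (leftRep (E n) σ (ip A x x') u') :=
    intTensor_ext σ fun y z => by
      have := congrArg (fun F => F u') (h1 y z)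
      simp only [ContinuousLinearMap.comp_apply, innerSL_apply_apply] at this ⊢
      rw [← inner_conj_symm, this, inner_conj_symm]
  have h3 := congrArg (fun F => F u) h2
  simp only [ContinuousLinearMap.comp_apply, innerSL_apply_apply] at h3
  rw [← inner_conj_symm, h3, inner_conj_symm]

/-- The isometry `E m ⊗ (E n ⊗_σ H) → E p ⊗_σ H`, `x ⊗ (y ⊗ h) ↦ xy ⊗ h`, where `p = m + n`. -/
def mulIsometry {m n p : Fin k → ℕ} (h : m + n = p) :
    IntTensor (E m) (leftRep (E n) σ) →ₗᵢ[ℂ] IntTensor (E p) σ :=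
  liftIsometry (leftRep (E n) σ) (X.mulOp σ h) (X.inner_mulOp σ h)

@[simp] theorem mulIsometry_tm {m n p : Fin k → ℕ} (h : m + n = p) (x : E m) (y : E n) (z : H) :
    X.mulIsometry σ h (tm (leftRep (E n) σ) x (tm σ y z)) = tm σ (X.mul h x y) z := by
  rw [mulIsometry, liftIsometry_tm, mulOp_tm]

theorem mulIsometry_surjective {m n p : Fin k → ℕ} (h : m + n = p) :
    Function.Surjective (X.mulIsometry σ h) := by
  let R : Submodule ℂ (IntTensor (E p) σ) := LinearMap.range (X.mulIsometry σ h).toLinearMap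
  have hR : IsClosed (R : Set (IntTensor (E p) σ)) := by
    exact (X.mulIsometry σ h).isometry.isClosedEmbedding.isClosed_range
  have h1 : ∀ z : H, (⊤ : Submodule ℂ (E p)) ≤ R.comap (tmL σ z).toLinearMap := by
    intro z
    rw [← X.dense_mul h]
    refine Submodule.topologicalClosure_minimal _ (Submodule.span_le.mpr ?_)
      (hR.preimage (tmL σ z).continuous)
    rintro _ ⟨x, y, rfl⟩
    exact ⟨_, X.mulIsometry_tm σ h x y z⟩
  have h2 : (⊤ : Submodule ℂ (IntTensor (E p) σ)) ≤ R := by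
    rw [← topologicalClosure_span_tm]
    refine Submodule.topologicalClosure_minimal _ (Submodule.span_le.mpr ?_) hR
    rintro _ ⟨x, z, rfl⟩
    exact h1 z (Submodule.mem_top (x := x))
  exact fun u => h2 (Submodule.mem_top (x := u))

/-- The unitary `E m ⊗ (E n ⊗_σ H) ≅ E p ⊗_σ H`, `x ⊗ (y ⊗ h) ↦ xy ⊗ h`, where `p = m + n`. -/
def mulUnitary {m n p : Fin k → ℕ} (h : m + n = p) :
    IntTensor (E m) (leftRep (E n) σ) ≃ₗᵢ[ℂ] IntTensor (E p) σ :=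
  LinearIsometryEquiv.ofSurjective (X.mulIsometry σ h) (X.mulIsometry_surjective σ h)

/-- The unitary `t_{i,j} ⊗ I_H : E_i ⊗ (E_j ⊗_σ H) → E_j ⊗ (E_i ⊗_σ H)`, where `E_i = E (ε i)`
and `t_{i,j}` is the flip `E_i ⊗ E_j ≅ E (ε i + ε j) ≅ E_j ⊗ E_i` of the product system. -/
def flip (i j : Fin k) :
    IntTensor (E (ε i)) (leftRep (E (ε j)) σ) ≃ₗᵢ[ℂ] IntTensor (E (ε j)) (leftRep (E (ε i)) σ) :=
  (X.mulUnitary σ (rfl : ε i + ε j = _)).trans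
    (X.mulUnitary σ (add_comm (ε j) (ε i))).symm

end ProductSystem
end ProductSystems

section Representations

variable {A : Type u} [NonUnitalCStarAlgebra A] [PartialOrder A] [StarOrderedRing A]
variable {H : Type w} [NormedAddCommGroup H] [InnerProductSpace ℂ H] [CompleteSpace H]

/-- Nondegeneracy of a representation: `σ(A)H` spans a dense subspace of `H`. -/
def IsNondegenerate (σ : A →⋆ₙₐ[ℂ] (H →L[ℂ] H)) : Prop :=
  (Submodule.span ℂ {z : H | ∃ a h, σ a h = z}).topologicalClosure = ⊤

theorem IsNondegenerate.ext {σ : A →⋆ₙₐ[ℂ] (H →L[ℂ] H)} (hσ : IsNondegenerate σ)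
    {G : Type*} [NormedAddCommGroup G] [NormedSpace ℂ G] {f g : H →L[ℂ] G}
    (h : ∀ a x, f (σ a x) = g (σ a x)) : f = g := by
  have h1 : (⊤ : Submodule ℂ H) ≤ LinearMap.eqLocus f.toLinearMap g.toLinearMap := by
    rw [← hσ]
    refine Submodule.topologicalClosure_minimal _ (Submodule.span_le.mpr ?_)
      (isClosed_eq f.continuous g.continuous)
    rintro _ ⟨a, x, rfl⟩
    exact h a x
  exact ContinuousLinearMap.ext fun x => h1 (Submodule.mem_top (x := x))

section
variable {E : Type v} [AddCommGroup E] [Module ℂ E] [SMul Aᵐᵒᵖ E] [Norm E] [CStarModule Aᵐᵒᵖ E]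
variable (σ : A →⋆ₙₐ[ℂ] (H →L[ℂ] H))

/-- The tensor product is balanced: `ξ a ⊗ h = ξ ⊗ σ(a) h`. -/
theorem tm_op_smul (ξ : E) (a : A) (h : H) : tm σ (op a • ξ) h = tm σ ξ (σ a h) := by
  have : innerSL ℂ (tm σ (op a • ξ) h) = innerSL ℂ (tm σ ξ (σ a h)) :=
    intTensor_ext σ fun η k => by
      simp only [innerSL_apply_apply, inner_tm, ip_smul_left, map_mul, map_star,
        mul_apply_eq_comp, ContinuousLinearMap.star_eq_adjoint,
        ContinuousLinearMap.adjoint_inner_right]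
  refine ext_inner_right ℂ fun z => ?_
  exact congrArg (fun F => F z) this

end

variable {k : ℕ}
variable {E : (Fin k → ℕ) → Type v} [∀ n, NormedAddCommGroup (E n)] [∀ n, NormedSpace ℂ (E n)]
    [∀ n, SMul Aᵐᵒᵖ (E n)] [∀ n, CStarModule Aᵐᵒᵖ (E n)] [∀ n, Correspondence A (E n)]

/-- The data `(σ, T⁽¹⁾, …, T⁽ᵏ⁾)` of a representation on `H` of a product system with fibres `E n`:
a *-homomorphism `σ : A → B(H)` and linear maps `T⁽ⁱ⁾ : E_i → B(H)`, where `E_i = E (ε i)`. -/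
structure RepData (A : Type u) [NonUnitalCStarAlgebra A] {k : ℕ} (E : (Fin k → ℕ) → Type v)
    [∀ n, NormedAddCommGroup (E n)] [∀ n, NormedSpace ℂ (E n)]
    (H : Type w) [NormedAddCommGroup H] [InnerProductSpace ℂ H] [CompleteSpace H] where
  /-- The representation of the coefficient algebra. -/
  σ : A →⋆ₙₐ[ℂ] (H →L[ℂ] H)
  /-- The representing maps of the correspondences `E_i`. -/
  T : ∀ i : Fin k, E (ε i) →ₗ[ℂ] (H →L[ℂ] H)

/-- Isomorphism (unitary equivalence) of representations. -/
def RepData.Isomorphic {K : Type*} [NormedAddCommGroup K] [InnerProductSpace ℂ K] [CompleteSpace K]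
    (R : RepData A E H) (S : RepData A E K) : Prop :=
  ∃ U : H ≃ₗᵢ[ℂ] K, (∀ a h, U (R.σ a h) = S.σ a (U h)) ∧ ∀ i ξ h, U (R.T i ξ h) = S.T i ξ (U h)

/-- Data `(σ, T⁽¹⁾, …, T⁽ᵏ⁾)` for which `σ` is nondegenerate and each `(σ, T⁽ⁱ⁾)` is an isometric
representation of the correspondence `E_i`. (The identity `T⁽ⁱ⁾(ξ)^* T⁽ⁱ⁾(η) = σ(⟨ξ, η⟩)` forces
`T⁽ⁱ⁾` to be completely contractive.) -/
structure IsometricTuple (A : Type u) [NonUnitalCStarAlgebra A] [PartialOrder A] {k : ℕ}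
    (E : (Fin k → ℕ) → Type v) [∀ n, NormedAddCommGroup (E n)] [∀ n, NormedSpace ℂ (E n)]
    [∀ n, SMul Aᵐᵒᵖ (E n)] [∀ n, CStarModule Aᵐᵒᵖ (E n)] [∀ n, Correspondence A (E n)]
    (H : Type w) [NormedAddCommGroup H] [InnerProductSpace ℂ H] [CompleteSpace H]
    extends RepData A E H where
  nondegenerate : IsNondegenerate σ
  covariant : ∀ (i : Fin k) (a b : A) (ξ : E (ε i)),
    T i (lact a (op b • ξ)) = (σ a).comp ((T i ξ).comp (σ b))
  isometric : ∀ (i : Fin k) (ξ η : E (ε i)),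
    (ContinuousLinearMap.adjoint (T i ξ)).comp (T i η) = σ (ip A ξ η)

namespace IsometricTuple

variable (R : IsometricTuple A E H)

/-- The isometry `T̃⁽ⁱ⁾ : E_i ⊗_σ H → H`, `ξ ⊗ h ↦ T⁽ⁱ⁾(ξ) h`. -/
def Ttilde (i : Fin k) : IntTensor (E (ε i)) R.σ →ₗᵢ[ℂ] H :=
  liftIsometry R.σ (R.T i) fun ξ η h k => by
    rw [← R.isometric, ContinuousLinearMap.comp_apply, ContinuousLinearMap.adjoint_inner_right]

@[simp] theorem Ttilde_tm (i : Fin k) (ξ : E (ε i)) (h : H) :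
    R.Ttilde i (tm R.σ ξ h) = R.T i ξ h := by
  rw [Ttilde, liftIsometry_tm]

/-- The operator `T̃⁽ⁱ⁾` as a bounded operator. -/
abbrev TtildeL (i : Fin k) : IntTensor (E (ε i)) R.σ →L[ℂ] H :=
  (R.Ttilde i).toContinuousLinearMap

theorem T_lact (i : Fin k) (a : A) (ξ : E (ε i)) : R.T i (lact a ξ) = (R.σ a).comp (R.T i ξ) := by
  have h1 : ∀ (b : A) (η : E (ε i)) (h : H), R.T i (op b • η) h = R.T i η (R.σ b h) := by
    intro b η h
    rw [← Ttilde_tm, tm_op_smul, Ttilde_tm]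
  refine R.nondegenerate.ext fun b h => ?_
  rw [← h1, ← lact_smul, R.covariant]
  rfl

/-- `T̃⁽ⁱ⁾ (φ(a) ⊗ I) = σ(a) T̃⁽ⁱ⁾`. -/
theorem TtildeL_leftRep (i : Fin k) (a : A) (u : IntTensor (E (ε i)) R.σ) :
    R.TtildeL i (leftRep (E (ε i)) R.σ a u) = R.σ a (R.TtildeL i u) := by
  have : (R.TtildeL i).comp (leftRep (E (ε i)) R.σ a) = (R.σ a).comp (R.TtildeL i) :=
    intTensor_ext R.σ fun ξ h => by
      simp [T_lact]
  exact congrArg (fun F => F u) this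

/-- `T̃⁽ⁱ⁾^* σ(a) = (φ(a) ⊗ I) T̃⁽ⁱ⁾^*`. -/
theorem adjoint_TtildeL_σ (i : Fin k) (a : A) (h : H) :
    ContinuousLinearMap.adjoint (R.TtildeL i) (R.σ a h) =
      leftRep (E (ε i)) R.σ a (ContinuousLinearMap.adjoint (R.TtildeL i) h) := by
  have h1 : ∀ a, star (leftRep (E (ε i)) R.σ a) = leftRep (E (ε i)) R.σ (star a) := fun a =>
    (map_star _ a).symm
  have h2 : ∀ a, star (R.σ a) = R.σ (star a) := fun a => (map_star _ a).symm
  refine ext_inner_right ℂ fun z => ?_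
  rw [ContinuousLinearMap.adjoint_inner_left, ← ContinuousLinearMap.adjoint_inner_right,
    ← ContinuousLinearMap.star_eq_adjoint, h2, ← TtildeL_leftRep, ← h1,
    ← ContinuousLinearMap.adjoint_inner_left, ContinuousLinearMap.star_eq_adjoint,
    ContinuousLinearMap.adjoint_inner_right]

/-- The operator `I_{E_j} ⊗ T̃⁽ⁱ⁾ : E_j ⊗ (E_i ⊗_σ H) → E_j ⊗_σ H`. -/
def ampTtilde (j i : Fin k) :
    IntTensor (E (ε j)) (leftRep (E (ε i)) R.σ) →L[ℂ] IntTensor (E (ε j)) R.σ :=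
  ampR (E (ε j)) (leftRep (E (ε i)) R.σ) R.σ (R.TtildeL i) (R.TtildeL_leftRep i)

/-- The operator `I_{E_i} ⊗ T̃⁽ʲ⁾^* : E_i ⊗_σ H → E_i ⊗ (E_j ⊗_σ H)`. -/
def ampTtildeAdjoint (i j : Fin k) :
    IntTensor (E (ε i)) R.σ →L[ℂ] IntTensor (E (ε i)) (leftRep (E (ε j)) R.σ) :=
  ampR (E (ε i)) R.σ (leftRep (E (ε j)) R.σ) (ContinuousLinearMap.adjoint (R.TtildeL j))
    (R.adjoint_TtildeL_σ j)

/-- The closed linear span of `{T⁽ⁱ⁾(ξ₁) ⋯ T⁽ⁱ⁾(ξ_l) h}`, the range of `T̃⁽ⁱ⁾_l`. -/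
def rangeSubspace (i : Fin k) (l : ℕ) : Submodule ℂ H :=
  (Submodule.span ℂ {z : H | ∃ (ξ : Fin l → E (ε i)) (h : H),
    (List.ofFn fun r => R.T i (ξ r)).prod h = z}).topologicalClosure

instance (i : Fin k) (l : ℕ) : CompleteSpace (R.rangeSubspace i l) :=
  (Submodule.isClosed_topologicalClosure _).completeSpace_coe

/-- The orthogonal projection `P^i_l` onto the closed linear span of
`{T⁽ⁱ⁾(ξ₁) ⋯ T⁽ⁱ⁾(ξ_l) h}`. -/
def P (i : Fin k) (l : ℕ) : H →L[ℂ] H := (R.rangeSubspace i l).starProjection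

instance (i : Fin k) : CompleteSpace (⨅ l, R.rangeSubspace i l : Submodule ℂ H) := by
  have : IsClosed ((⨅ l, R.rangeSubspace i l : Submodule ℂ H) : Set H) := by
    rw [Submodule.coe_iInf]
    exact isClosed_iInter fun l => Submodule.isClosed_topologicalClosure _
  exact this.completeSpace_coe

/-- The infimum `P^i_∞` of the projections `P^i_l`, `l ∈ ℕ`, i.e. the orthogonal projection onto
the intersection of their ranges. -/
def Pinf (i : Fin k) : H →L[ℂ] H := (⨅ l, R.rangeSubspace i l : Submodule ℂ H).starProjection

end IsometricTuple

/-- An isometric representation on `H` of the product system `X`: a nondegenerate representation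
`σ` of `A` and isometric covariant representations `(σ, T⁽ⁱ⁾)` of the `E_i` such that
`T̃⁽ⁱ⁾(I ⊗ T̃⁽ʲ⁾) = T̃⁽ʲ⁾(I ⊗ T̃⁽ⁱ⁾)(t_{i,j} ⊗ I)` for all `i, j`. -/
structure IsometricRep (X : ProductSystem A E) (H : Type w) [NormedAddCommGroup H]
    [InnerProductSpace ℂ H] [CompleteSpace H] extends IsometricTuple A E H where
  comm : ∀ i j : Fin k,
    (toIsometricTuple.TtildeL i).comp (toIsometricTuple.ampTtilde i j) =
      (toIsometricTuple.TtildeL j).comp ((toIsometricTuple.ampTtilde j i).comp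
        (X.flip σ i j).toContinuousLinearEquiv.toContinuousLinearMap)

/-- Double commutation: `T̃⁽ʲ⁾^* T̃⁽ⁱ⁾ = (I ⊗ T̃⁽ⁱ⁾)(t_{i,j} ⊗ I)(I ⊗ T̃⁽ʲ⁾^*)` for `i ≠ j`. -/
def IsometricRep.DoublyCommuting {X : ProductSystem A E} (R : IsometricRep X H) : Prop :=
  ∀ i j : Fin k, i ≠ j →
    (ContinuousLinearMap.adjoint (R.TtildeL j)).comp (R.TtildeL i) =
      (R.ampTtilde j i).comp
        ((X.flip R.σ i j).toContinuousLinearEquiv.toContinuousLinearMap.comp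
          (R.ampTtildeAdjoint i j))

end Representations

section Fock

variable {A : Type u} [NonUnitalCStarAlgebra A] [PartialOrder A] [StarOrderedRing A]

theorem summable_of_nonneg_of_le {ι : Type*} {f g : ι → A} (hf : ∀ i, 0 ≤ f i)
    (hfg : ∀ i, f i ≤ g i) (hg : Summable g) : Summable f := by
  rw [summable_iff_vanishing_norm] at hg ⊢
  intro r hr
  obtain ⟨s, hs⟩ := hg r hr
  refine ⟨s, fun t ht => lt_of_le_of_lt ?_ (hs t ht)⟩
  exact CStarAlgebra.norm_le_norm_of_nonneg_of_le (Finset.sum_nonneg fun i _ => hf i)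
    (Finset.sum_le_sum fun i _ => hfg i)

section
variable {E : Type v} [AddCommGroup E] [Module ℂ E] [SMul Aᵐᵒᵖ E] [Norm E] [CStarModule Aᵐᵒᵖ E]

theorem ip_add_right (x y z : E) : ip A x (y + z) = ip A x y + ip A x z :=
  map_add (ipₛₗ A E x) y z

theorem ip_add_left (x y z : E) : ip A (x + y) z = ip A x z + ip A y z := by
  simp [ip]

theorem ip_smulc_right (c : ℂ) (x y : E) : ip A x (c • y) = c • ip A x y :=
  map_smul (ipₛₗ A E x) c y

theorem ip_smulc_left (c : ℂ) (x y : E) : ip A (c • x) y = starRingEnd ℂ c • ip A x y := by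
  rw [← star_ip, ip_smulc_right, star_smul, star_ip]; rfl

theorem ip_zero_left (x : E) : ip A 0 x = 0 := by simp [ip]

theorem ip_zero_right (x : E) : ip A x 0 = 0 := by simp [ip]

theorem op_smul_zero (a : A) : op a • (0 : E) = 0 :=
  ip_ext (A := A) fun z => by rw [ip_smul_right, ip_zero_right, zero_mul]

theorem ip_add_self_le (x y : E) :
    ip A (x + y) (x + y) ≤ (2 : ℂ) • ip A x x + (2 : ℂ) • ip A y y := by
  rw [← sub_nonneg]
  convert ip_self_nonneg (A := A) (x - y) using 1
  simp only [ip_add_left, ip_add_right, ip_sub_left, ip_sub_right]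
  module

theorem ip_polarization (x y : E) : ip A x y = (1 / 4 : ℂ) • (ip A (x + y) (x + y)
    - ip A (x - y) (x - y) - Complex.I • ip A (x + Complex.I • y) (x + Complex.I • y)
    + Complex.I • ip A (x - Complex.I • y) (x - Complex.I • y)) := by
  simp only [ip_add_left, ip_add_right, ip_sub_left, ip_sub_right, ip_smulc_left, ip_smulc_right,
    Complex.conj_I, smul_add, smul_sub, smul_smul]
  match_scalars <;> (ring_nf; try simp only [Complex.I_sq]; try norm_num)
end

section
variable {ι : Type*} {E : ι → Type v} [∀ n, AddCommGroup (E n)] [∀ n, Module ℂ (E n)]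
  [∀ n, SMul Aᵐᵒᵖ (E n)] [∀ n, Norm (E n)] [∀ n, CStarModule Aᵐᵒᵖ (E n)]

variable (A E) in
/-- The families `(x n)` with `∑ ⟨x n, x n⟩` convergent in `A`, as a subspace of the product. -/
def dirSumSubmodule : Submodule ℂ (∀ n, E n) where
  carrier := {x | Summable fun n => ip A (x n) (x n)}
  zero_mem' := by simp [ip_zero_left]
  add_mem' {x y} hx hy := summable_of_nonneg_of_le (fun n => ip_self_nonneg _)
    (fun n => ip_add_self_le (x n) (y n)) ((hx.const_smul (2 : ℂ)).add (hy.const_smul (2 : ℂ)))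
  smul_mem' c x hx := by
    have h1 : Summable fun n => ip A (x n) (x n) := hx
    have h2 : Summable fun n => (starRingEnd ℂ c * c) • ip A (x n) (x n) := h1.const_smul _
    exact h2.congr fun n => by rw [Pi.smul_apply, ip_smulc_left, ip_smulc_right, smul_smul]

variable (A E) in
/-- The direct sum `⨁ E n` of Hilbert `A`-modules: all families `(x n)` for which `∑ ⟨x n, x n⟩`
converges in the norm of `A`, with the inner product `⟨x, y⟩ = ∑ ⟨x n, y n⟩`. -/
def DirSum : Type _ := dirSumSubmodule A E

namespace DirSum

instance : AddCommGroup (DirSum A E) := inferInstanceAs (AddCommGroup (dirSumSubmodule A E))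
instance : Module ℂ (DirSum A E) := inferInstanceAs (Module ℂ (dirSumSubmodule A E))

/-- The components of an element of the direct sum. -/
instance : CoeFun (DirSum A E) fun _ => ∀ n, E n := ⟨Subtype.val⟩

theorem summable_self (x : DirSum A E) : Summable fun n => ip A (x n) (x n) := x.2

@[ext] theorem ext {x y : DirSum A E} (h : ∀ n, x n = y n) : x = y := Subtype.ext (funext h)

@[simp] theorem add_apply (x y : DirSum A E) (n : ι) : (x + y) n = x n + y n := rfl
@[simp] theorem sub_apply (x y : DirSum A E) (n : ι) : (x - y) n = x n - y n := rfl
@[simp] theorem smul_apply (c : ℂ) (x : DirSum A E) (n : ι) : (c • x) n = c • x n := rfl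
@[simp] theorem zero_apply (n : ι) : (0 : DirSum A E) n = 0 := rfl

theorem summable_ip (x y : DirSum A E) : Summable fun n => ip A (x n) (y n) := by
  have h := ((((summable_self (x + y)).sub (summable_self (x - y))).sub
    ((summable_self (x + Complex.I • y)).const_smul Complex.I)).add
    ((summable_self (x - Complex.I • y)).const_smul Complex.I)).const_smul (1 / 4 : ℂ)
  exact h.congr fun n => (ip_polarization (x n) (y n)).symm

instance : SMul Aᵐᵒᵖ (DirSum A E) where
  smul a x := ⟨fun n => a • x n, by
    have := (x.summable_self.mul_left (star (unop a))).mul_right (unop a)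
    exact this.congr fun n => by
      rw [← op_unop a, ip_smul_left, ip_smul_right, unop_op, mul_assoc]⟩

@[simp] theorem op_smul_apply (a : Aᵐᵒᵖ) (x : DirSum A E) (n : ι) : (a • x) n = a • x n := rfl

instance : Inner Aᵐᵒᵖ (DirSum A E) where
  inner x y := op (∑' n, ip A (x n) (y n))

instance : Norm (DirSum A E) := CStarModule.norm Aᵐᵒᵖ

instance : CStarModule Aᵐᵒᵖ (DirSum A E) where
  inner_add_right {x y z} := by
    refine unop_injective ?_
    change ∑' n, ip A (x n) ((y + z) n) = ∑' n, ip A (x n) (y n) + ∑' n, ip A (x n) (z n)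
    rw [← (summable_ip x y).tsum_add (summable_ip x z)]
    simp only [add_apply, ip_add_right]
  inner_self_nonneg {x} := by
    change 0 ≤ ∑' n, ip A (x n) (x n)
    exact tsum_nonneg fun n => ip_self_nonneg _
  inner_self {x} := by
    constructor
    · intro h
      have h0 : ∑' n, ip A (x n) (x n) = 0 := congrArg unop h
      ext n
      rw [zero_apply, ← ip_self_eq_zero (A := A)]
      refine le_antisymm ?_ (ip_self_nonneg _)
      rw [← h0]
      exact x.summable_self.le_tsum n fun j _ => ip_self_nonneg _
    · rintro rfl
      refine unop_injective ?_
      change ∑' n, ip A ((0 : DirSum A E) n) ((0 : DirSum A E) n) = 0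
      simp [ip_zero_left]
  inner_op_smul_right {a x y} := by
    refine unop_injective ?_
    change ∑' n, ip A (x n) ((a • y) n) = (∑' n, ip A (x n) (y n)) * unop a
    rw [← (summable_ip x y).tsum_mul_right]
    refine tsum_congr fun n => ?_
    rw [op_smul_apply, ← op_unop a, ip_smul_right, unop_op]
  inner_smul_right_complex {c x y} := by
    refine unop_injective ?_
    change ∑' n, ip A (x n) ((c • y) n) = c • ∑' n, ip A (x n) (y n)
    rw [← (summable_ip x y).tsum_const_smul]
    simp only [smul_apply, ip_smulc_right]
  star_inner x y := by
    refine unop_injective ?_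
    change star (∑' n, ip A (x n) (y n)) = ∑' n, ip A (y n) (x n)
    rw [tsum_star]
    simp only [star_ip]
  norm_eq_sqrt_norm_inner_self _ := rfl

theorem ip_def (x y : DirSum A E) : ip A x y = ∑' n, ip A (x n) (y n) := rfl

instance [∀ n, LeftAction A (E n)] : LeftAction A (DirSum A E) where
  lact :=
    { toFun := fun a =>
        { toFun := fun x => ⟨fun n => lact a (x n),
            summable_of_nonneg_of_le (fun n => ip_self_nonneg _) (fun n => lact_bound a (x n))
              (x.summable_self.const_smul (‖a‖ ^ 2))⟩
          map_add' := fun x y => DirSum.ext fun n => map_add _ _ _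
          map_smul' := fun c x => DirSum.ext fun n => map_smul _ _ _ }
      map_smul' := fun c a => LinearMap.ext fun x => DirSum.ext fun n => by
        change lact (c • a) (x n) = c • lact a (x n)
        rw [map_smul]; rfl
      map_zero' := LinearMap.ext fun x => DirSum.ext fun n => by
        change lact (0 : A) (x n) = 0
        rw [map_zero]; rfl
      map_add' := fun a b => LinearMap.ext fun x => DirSum.ext fun n => by
        change lact (a + b) (x n) = lact a (x n) + lact b (x n)
        rw [map_add]; rfl
      map_mul' := fun a b => LinearMap.ext fun x => DirSum.ext fun n => by
        change lact (a * b) (x n) = lact a (lact b (x n))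
        rw [map_mul]; rfl }
  ip_lact a x y := tsum_congr fun n => ip_lact a (x n) (y n)

@[simp] theorem lact_apply [∀ n, LeftAction A (E n)] (a : A) (x : DirSum A E) (n : ι) :
    (lact a x : DirSum A E) n = lact a (x n) := rfl

end DirSum
end

variable {k : ℕ}
variable {E : (Fin k → ℕ) → Type v} [∀ n, NormedAddCommGroup (E n)] [∀ n, NormedSpace ℂ (E n)]
    [∀ n, SMul Aᵐᵒᵖ (E n)] [∀ n, CStarModule Aᵐᵒᵖ (E n)] [∀ n, Correspondence A (E n)]

variable (A E) in
/-- The Fock module `F(𝔼) = ⨁_{n ∈ ℕ₀^k} E n`, with the diagonal left action `φ_∞` of `A`. -/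
abbrev Fock : Type _ := DirSum A E

namespace ProductSystem

variable (X : ProductSystem A E)

open scoped Classical in
/-- The components of `T_ξ x` for `ξ ∈ E m` and a family `x`: the component at `m + n` is
`ξ (x n)`, and the components at indices that are not `≥ m` vanish. -/
def creationFun {m : Fin k → ℕ} (ξ : E m) (x : ∀ n, E n) (n : Fin k → ℕ) : E n :=
  if h : m ≤ n then X.mul (add_tsub_cancel_of_le h) ξ (x (n - m)) else 0

open scoped Classical in
/-- The function dominating the squares of the components of `T_ξ x`. -/
def creationDom {m : Fin k → ℕ} (ξ : E m) (x : Fock A E) (n : Fin k → ℕ) : A :=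
  if m ≤ n then (‖ξ‖ ^ 2) • ip A (x (n - m)) (x (n - m)) else 0

theorem creation_le {m : Fin k → ℕ} (ξ : E m) (x : Fock A E) (n : Fin k → ℕ) :
    ip A (X.creationFun ξ x n) (X.creationFun ξ x n) ≤ creationDom ξ x n := by
  unfold creationFun creationDom
  split_ifs with h
  · exact X.mul_bound _ _ _
  · rw [ip_zero_left]

theorem hasSum_creationDom {m : Fin k → ℕ} (ξ : E m) (x : Fock A E) :
    HasSum (creationDom ξ x) ((‖ξ‖ ^ 2) • ip A x x) := by
  have hinj : Function.Injective (fun n : Fin k → ℕ => m + n) := add_right_injective m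
  rw [← hinj.hasSum_iff]
  · have := (x.summable_self.hasSum).const_smul (‖ξ‖ ^ 2)
    refine this.congr_fun fun n => ?_
    simp only [creationDom, Function.comp_apply, le_add_iff_nonneg_right, zero_le, if_true]
    rw [show m + n - m = n from add_tsub_cancel_left m n]
  · intro n hn
    have : ¬ m ≤ n := fun h => hn ⟨n - m, add_tsub_cancel_of_le h⟩
    simp [creationDom, this]

/-- The creation (Toeplitz) operator `T_ξ` on the Fock module: left multiplication by `ξ`. -/
def creation {m : Fin k → ℕ} (ξ : E m) : Fock A E →ₗ[ℂ] Fock A E where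
  toFun x := ⟨X.creationFun ξ x, summable_of_nonneg_of_le (fun n => ip_self_nonneg _)
    (X.creation_le ξ x) (hasSum_creationDom ξ x).summable⟩
  map_add' x y := DirSum.ext fun n => by
    change X.creationFun ξ _ n = X.creationFun ξ _ n + X.creationFun ξ _ n
    unfold creationFun
    split_ifs with h
    · exact map_add _ _ _
    · simp
  map_smul' c x := DirSum.ext fun n => by
    change X.creationFun ξ _ n = c • X.creationFun ξ _ n
    unfold creationFun
    split_ifs with h
    · exact map_smul _ _ _
    · simp

open scoped Classical in
theorem creation_apply {m : Fin k → ℕ} (ξ : E m) (x : Fock A E) (n : Fin k → ℕ) :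
    X.creation ξ x n =
      if h : m ≤ n then X.mul (add_tsub_cancel_of_le h) ξ (x (n - m)) else 0 := rfl

theorem creation_op_smul {m : Fin k → ℕ} (ξ : E m) (x : Fock A E) (a : A) :
    X.creation ξ (op a • x) = op a • X.creation ξ x := DirSum.ext fun n => by
  rw [DirSum.op_smul_apply, creation_apply, creation_apply]
  split_ifs with h
  · exact X.mul_smul _ _ _ _
  · rw [op_smul_zero]

theorem creation_bound {m : Fin k → ℕ} (ξ : E m) (x : Fock A E) :
    ip A (X.creation ξ x) (X.creation ξ x) ≤ (‖ξ‖ ^ 2) • ip A x x := by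
  rw [DirSum.ip_def, ← (hasSum_creationDom ξ x).tsum_eq]
  exact (X.creation ξ x).summable_self.tsum_le_tsum (X.creation_le ξ x)
    (hasSum_creationDom ξ x).summable

theorem creation_add {m : Fin k → ℕ} (ξ η : E m) (x : Fock A E) :
    X.creation (ξ + η) x = X.creation ξ x + X.creation η x := DirSum.ext fun n => by
  rw [DirSum.add_apply, creation_apply, creation_apply, creation_apply]
  split_ifs with h
  · simp
  · simp

theorem creation_smul {m : Fin k → ℕ} (c : ℂ) (ξ : E m) (x : Fock A E) :
    X.creation (c • ξ) x = c • X.creation ξ x := DirSum.ext fun n => by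
  rw [DirSum.smul_apply, creation_apply, creation_apply]
  split_ifs with h
  · simp
  · simp

variable {K : Type w} [NormedAddCommGroup K] [InnerProductSpace ℂ K] [CompleteSpace K]

/-- The representation of the product system induced by a representation `π` of `A` on `K`: it acts
on `F(𝔼) ⊗_π K` by `σ(a) = φ_∞(a) ⊗ I_K` and `T⁽ⁱ⁾(ξ) = T_ξ ⊗ I_K`. -/
def induced (π : A →⋆ₙₐ[ℂ] (K →L[ℂ] K)) : RepData A E (IntTensor (Fock A E) π) where
  σ := leftRep (Fock A E) π
  T i :=
    { toFun := fun ξ => ampL π (X.creation ξ) ‖ξ‖ (X.creation_op_smul ξ) (X.creation_bound ξ)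
      map_add' := fun ξ η => intTensor_ext π fun x h => by
        simp [creation_add, tm_add_left]
      map_smul' := fun c ξ => intTensor_ext π fun x h => by
        simp [creation_smul, tm_smul_left] }

end ProductSystem

variable {H : Type w} [NormedAddCommGroup H] [InnerProductSpace ℂ H] [CompleteSpace H]

/-- The representation is isomorphic to the representation induced by some (nondegenerate)
representation `π` of `A` on a Hilbert space `K`. -/
def IsometricRep.IsomorphicToInduced {X : ProductSystem A E} (R : IsometricRep X H) : Prop :=
  ∃ (K : Type w) (_ : NormedAddCommGroup K) (_ : InnerProductSpace ℂ K) (_ : CompleteSpace K)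
    (π : A →⋆ₙₐ[ℂ] (K →L[ℂ] K)), IsNondegenerate π ∧ R.toRepData.Isomorphic (X.induced π)

end Fock

end ProductSystemWold

end

/-!
The Wold decomposition for doubly commuting isometric representations of product systems.

The representation `(σ, T⁽¹⁾, …, T⁽ᵏ⁾)` extends to maps `T_n : E n → B(H)` on all fibres with
`T_n(ξ)^* T_n(η) = σ(⟨ξ, η⟩)` and `T_{ε i + m}(ξη) = T⁽ⁱ⁾(ξ) T_m(η)` (`IsometricRep.ext`,
`IsometricRep.ext_mul`); independence of the order of factorisation is the commutation relation.
Let `W_i` be the orthogonal complement of the range of `T̃⁽ⁱ⁾` and `𝒲 = ⋂ W_i`. Double commutation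
says that `T⁽ʲ⁾(ξ)` preserves `W_i` for `j ≠ i`, and commutation that `T⁽ʲ⁾(ξ)^*` does. It follows
that `T_m(ξ) h ⟂ T_n(η) h'` for `m ≠ n` and `h, h' ∈ 𝒲`
(`IsometricRep.DoublyCommuting.inner_ext_of_ne`). So these vectors have the same Gram matrix as the
vectors `δ_n(ξ) ⊗ h` of `F(𝔼) ⊗_π 𝒲`, where `π` is the restriction of `σ` to `𝒲`. The latter span
the induced space (`DirSum.closedSpan_tm_single`), and it remains to see when the former span `H`.

The complement `N` of their closed span reduces all `T⁽ⁱ⁾` and `N ∩ 𝒲 = 0`. A closed subspace `L`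
reducing `T⁽ʲ⁾` with `L ∩ W_j = 0` is the closed span of `T⁽ʲ⁾(E_j) L`, hence lies in the range of
`P^j_∞` (`IsometricTuple.mem_rangeSubspace_of_reducing`). If all `P^j_∞` vanish, this applies to the
intersections of `N` with fewer and fewer of the `W_i`, one index at a time, and yields `N = 0`
(`IsometricRep.DoublyCommuting.generated_eq_top`).

Conversely, in an induced representation words of length `l` in `T⁽ⁱ⁾` take values in the part of
the Fock space supported on the indices with `n i ≥ l`, and these parts intersect in `0`
(`IsometricRep.IsomorphicToInduced.Pinf_eq_zero`).
-/

noncomputable section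

namespace ProductSystemWold

open MulOpposite LeftAction

universe u v w

/-! ### Closed linear spans and unitaries -/

section ClosedSpan

variable {G : Type*} [NormedAddCommGroup G] [NormedSpace ℂ G]
variable {G' : Type*} [NormedAddCommGroup G'] [NormedSpace ℂ G']

theorem map_mem_of_mem_closedSpan {S : Set G} {M : Submodule ℂ G'}
    (hM : IsClosed (M : Set G')) (f : G →L[ℂ] G') (h : ∀ s ∈ S, f s ∈ M) {x : G}
    (hx : x ∈ (Submodule.span ℂ S).topologicalClosure) : f x ∈ M := by
  have h1 : (Submodule.span ℂ S).topologicalClosure ≤ M.comap f.toLinearMap :=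
    Submodule.topologicalClosure_minimal _ (Submodule.span_le.mpr h) (hM.preimage f.continuous)
  exact h1 hx

theorem map_mem_of_closedSpan_eq_top {S : Set G}
    (hS : (Submodule.span ℂ S).topologicalClosure = ⊤) {M : Submodule ℂ G'}
    (hM : IsClosed (M : Set G')) (f : G →L[ℂ] G') (h : ∀ s ∈ S, f s ∈ M) (x : G) : f x ∈ M :=
  map_mem_of_mem_closedSpan hM f h (hS ▸ Submodule.mem_top)

theorem eq_of_closedSpan_eq_top {S : Set G}
    (hS : (Submodule.span ℂ S).topologicalClosure = ⊤) {f g : G →L[ℂ] G'}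
    (h : ∀ s ∈ S, f s = g s) (x : G) : f x = g x := by
  have h1 := map_mem_of_closedSpan_eq_top hS (M := (⊥ : Submodule ℂ G'))
    (by simp) (f - g) (fun s hs => by simp [h s hs]) x
  simpa [sub_eq_zero] using h1

end ClosedSpan

section Gram

variable {H : Type*} [NormedAddCommGroup H] [InnerProductSpace ℂ H] [CompleteSpace H]
variable {K : Type*} [NormedAddCommGroup K] [InnerProductSpace ℂ K] [CompleteSpace K]

theorem closedSpan_eq_top_of_orthogonal {S : Set H}
    (h : ∀ v : H, (∀ s ∈ S, inner ℂ s v = 0) → v = 0) :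
    (Submodule.span ℂ S).topologicalClosure = ⊤ := by
  rw [Submodule.topologicalClosure_eq_top_iff, Submodule.eq_bot_iff]
  exact fun v hv => h v fun s hs =>
    (Submodule.mem_orthogonal _ _).mp hv s (Submodule.subset_span hs)

/-- Two total families with the same Gram matrix are related by a unitary. -/
theorem exists_unitary_of_gram {ι : Type*} (x : ι → H) (y : ι → K)
    (hx : (Submodule.span ℂ (Set.range x)).topologicalClosure = ⊤)
    (hy : (Submodule.span ℂ (Set.range y)).topologicalClosure = ⊤)
    (hxy : ∀ i j, inner ℂ (x i) (x j) = inner ℂ (y i) (y j)) :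
    ∃ U : H ≃ₗᵢ[ℂ] K, ∀ i, U (x i) = y i := by
  let f := Finsupp.linearCombination ℂ x
  let g := Finsupp.linearCombination ℂ y
  have hf : DenseRange f := by
    have := Submodule.dense_iff_topologicalClosure_eq_top.mpr hx
    rwa [← Finsupp.range_linearCombination, LinearMap.coe_range] at this
  have hg : DenseRange g := by
    have := Submodule.dense_iff_topologicalClosure_eq_top.mpr hy
    rwa [← Finsupp.range_linearCombination, LinearMap.coe_range] at this
  have hfg : ∀ c, ‖g c‖ = ‖f c‖ := fun c => by
    have : inner ℂ (g c) (g c) = inner ℂ (f c) (f c) := by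
      simp only [f, g, Finsupp.linearCombination_apply, Finsupp.sum, sum_inner, inner_sum,
        inner_smul_left, inner_smul_right, hxy]
    rw [norm_eq_sqrt_re_inner (𝕜 := ℂ), this, ← norm_eq_sqrt_re_inner]
  refine ⟨LinearEquiv.extendOfIsometry (LinearEquiv.refl ℂ (ι →₀ ℂ)) f g hf hg hfg, fun i => ?_⟩
  have := LinearEquiv.extendOfIsometry_eq (LinearEquiv.refl ℂ (ι →₀ ℂ)) f g hf hg hfg
    (Finsupp.single i 1)
  simpa [f, g] using this

end Gram

/-! ### Finitely supported vectors in the Fock module -/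

namespace DirSum

variable {A : Type u} [NonUnitalCStarAlgebra A] [PartialOrder A] [StarOrderedRing A]
variable {ι : Type*} {E : ι → Type v} [∀ n, AddCommGroup (E n)] [∀ n, Module ℂ (E n)]
  [∀ n, SMul Aᵐᵒᵖ (E n)] [∀ n, Norm (E n)] [∀ n, CStarModule Aᵐᵒᵖ (E n)]

open scoped Classical in
variable (A) in
/-- The family in `⨁ E n` with the single nonzero component `ξ` at the index `n`. -/
def single (n : ι) (ξ : E n) : DirSum A E :=
  ⟨Pi.single n ξ, summable_of_ne_finset_zero (s := {n}) fun m hm => by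
    rw [Pi.single_eq_of_ne (by simpa using hm), ip_zero_left]⟩

@[simp] theorem single_same (n : ι) (ξ : E n) : single A n ξ n = ξ := by
  classical
  exact Pi.single_eq_same n ξ

theorem single_ne {m n : ι} (h : m ≠ n) (ξ : E n) : single A n ξ m = 0 := by
  classical
  exact Pi.single_eq_of_ne h ξ

theorem ip_single_left (n : ι) (ξ : E n) (x : DirSum A E) :
    ip A (single A n ξ) x = ip A ξ (x n) := by
  rw [ip_def, tsum_eq_single n fun m hm => by rw [single_ne hm, ip_zero_left], single_same]

theorem ip_single_single (n : ι) (ξ η : E n) :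
    ip A (single A n ξ) (single A n η) = ip A ξ η := by
  rw [ip_single_left, single_same]

theorem ip_single_single_of_ne {m n : ι} (h : m ≠ n) (ξ : E m) (η : E n) :
    ip A (single A m ξ) (single A n η) = 0 := by
  rw [ip_single_left, single_ne h, ip_zero_right]

theorem lact_single [∀ n, LeftAction A (E n)] (a : A) (n : ι) (ξ : E n) :
    lact a (single A n ξ) = single A n (lact a ξ) := ext fun m => by
  rw [lact_apply]
  rcases eq_or_ne m n with rfl | h
  · simp
  · rw [single_ne h, single_ne h, map_zero]

theorem sum_single_apply_mem (s : Finset ι) (x : DirSum A E) {m : ι} (hm : m ∈ s) :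
    (∑ n ∈ s, single A n (x n)) m = x m := by
  classical
  have h : ∀ t : Finset ι, (∑ n ∈ t, single A n (x n)) m = ∑ n ∈ t, (single A n (x n) m) := by
    intro t
    induction t using Finset.induction_on with
    | empty => simp
    | insert a t ha ih => rw [Finset.sum_insert ha, Finset.sum_insert ha, add_apply, ih]
  rw [h, Finset.sum_eq_single_of_mem m hm fun n _ hn => single_ne hn.symm _, single_same]

theorem sum_single_apply_not_mem (s : Finset ι) (x : DirSum A E) {m : ι} (hm : m ∉ s) :
    (∑ n ∈ s, single A n (x n)) m = 0 := by
  classical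
  induction s using Finset.induction_on with
  | empty => simp
  | insert a t ha ih =>
    rw [Finset.mem_insert, not_or] at hm
    rw [Finset.sum_insert ha, add_apply, ih hm.2, single_ne hm.1, add_zero]

theorem ip_self_sub_sum_single (s : Finset ι) (x : DirSum A E) :
    ip A (x - ∑ n ∈ s, single A n (x n)) (x - ∑ n ∈ s, single A n (x n)) =
      ip A x x - ∑ n ∈ s, ip A (x n) (x n) := by
  classical
  rw [eq_sub_iff_add_eq, ip_def, ip_def, ← (x.summable_self).sum_add_tsum_compl (s := s),
    add_comm]
  congr 1
  rw [← Summable.sum_add_tsum_compl (s := s) (summable_self _)]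
  rw [Finset.sum_eq_zero fun n hn => by
    rw [sub_apply, sum_single_apply_mem s x hn, sub_self, ip_zero_left], zero_add]
  refine tsum_congr fun n => ?_
  rw [sub_apply, sum_single_apply_not_mem s x n.2, sub_zero]

variable {K : Type w} [NormedAddCommGroup K] [InnerProductSpace ℂ K] [CompleteSpace K]
variable (π : A →⋆ₙₐ[ℂ] (K →L[ℂ] K))

/-- The elementary tensors whose left factor sits in one fibre span a dense subspace of
`(⨁ E n) ⊗_π K`. -/
theorem closedSpan_tm_single :
    (Submodule.span ℂ {z : IntTensor (DirSum A E) π |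
      ∃ (n : ι) (ξ : E n) (h : K), tm π (single A n ξ) h = z}).topologicalClosure = ⊤ := by
  set M := (Submodule.span ℂ {z : IntTensor (DirSum A E) π |
      ∃ (n : ι) (ξ : E n) (h : K), tm π (single A n ξ) h = z}) with hM
  refine top_le_iff.mp ?_
  rw [← topologicalClosure_span_tm]
  refine Submodule.topologicalClosure_minimal _ (Submodule.span_le.mpr ?_)
    (Submodule.isClosed_topologicalClosure _)
  rintro _ ⟨x, h, rfl⟩
  have hmem : ∀ s : Finset ι, tm π (∑ n ∈ s, single A n (x n)) h ∈ M := by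
    classical
    intro s
    induction s using Finset.induction_on with
    | empty =>
      rw [Finset.sum_empty, ← zero_smul ℂ (0 : DirSum A E), tm_smul_left, zero_smul]
      exact zero_mem _
    | insert a t ha ih =>
      rw [Finset.sum_insert ha, tm_add_left]
      exact add_mem (Submodule.subset_span ⟨_, _, _, rfl⟩) ih
  have hn : Filter.Tendsto (fun s : Finset ι => ‖x - ∑ n ∈ s, single A n (x n)‖)
      Filter.atTop (nhds 0) := by
    have h1 : Filter.Tendsto (fun s : Finset ι => ‖ip A x x - ∑ n ∈ s, ip A (x n) (x n)‖)
        Filter.atTop (nhds 0) := by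
      have := (tendsto_const_nhds (x := ip A x x)).sub x.summable_self.hasSum
      rw [← ip_def, sub_self] at this
      exact tendsto_zero_iff_norm_tendsto_zero.mp this
    have h2 := h1.sqrt
    rw [Real.sqrt_zero] at h2
    refine h2.congr fun s => ?_
    rw [← ip_self_sub_sum_single, norm_ip_self, Real.sqrt_sq (CStarModule.norm_nonneg Aᵐᵒᵖ)]
  refine mem_closure_of_tendsto (b := Filter.atTop)
    (f := fun s : Finset ι => tm π (∑ n ∈ s, single A n (x n)) h) ?_
    (Filter.Eventually.of_forall hmem)
  rw [tendsto_iff_norm_sub_tendsto_zero]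
  refine squeeze_zero (fun _ => norm_nonneg _) (fun s => ?_)
    (by simpa using hn.mul_const ‖h‖)
  rw [norm_sub_rev]
  refine le_trans (le_of_eq ?_) (norm_tm_le π (x - ∑ n ∈ s, single A n (x n)) h)
  congr 1
  rw [sub_eq_iff_eq_add, ← tm_add_left, sub_add_cancel]

end DirSum

namespace ProductSystem

variable {A : Type u} [NonUnitalCStarAlgebra A] [PartialOrder A] [StarOrderedRing A]
variable {k : ℕ}
variable {E : (Fin k → ℕ) → Type v} [∀ n, NormedAddCommGroup (E n)] [∀ n, NormedSpace ℂ (E n)]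
    [∀ n, SMul Aᵐᵒᵖ (E n)] [∀ n, CStarModule Aᵐᵒᵖ (E n)] [∀ n, Correspondence A (E n)]
variable (X : ProductSystem A E)

theorem creation_single {m n p : Fin k → ℕ} (h : m + n = p) (ξ : E m) (η : E n) :
    X.creation ξ (DirSum.single A n η) = DirSum.single A p (X.mul h ξ η) := by
  refine DirSum.ext fun q => ?_
  rw [creation_apply]
  split_ifs with hq
  · have aux : ∀ r (hr : m + r = q),
        X.mul hr ξ (DirSum.single A n η r) = DirSum.single A p (X.mul h ξ η) q := by
      intro r hr
      rcases eq_or_ne r n with rfl | hrn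
      · obtain rfl : p = q := h.symm.trans hr
        simp
      · have : q ≠ p := fun e => hrn (add_left_cancel (hr.trans (e.trans h.symm)))
        rw [DirSum.single_ne hrn, DirSum.single_ne this, map_zero]
    exact aux _ _
  · rw [DirSum.single_ne]
    rintro rfl
    exact hq (h ▸ le_self_add)

/-- Evaluation of a creation operator against a vector in the fibre of `m + n`. -/
theorem ip_single_mul_creation {m n p : Fin k → ℕ} (h : m + n = p) (ξ ξ' : E m) (η : E n)
    (x : Fock A E) :
    ip A (DirSum.single A p (X.mul h ξ η)) (X.creation ξ' x) =
      ip A (DirSum.single A n (lact (ip A ξ' ξ) η)) x := by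
  have hmp : m ≤ p := h ▸ le_self_add
  have aux : ∀ r (hr : m + r = p), ip A (X.mul h ξ η) (X.mul hr ξ' (x r)) =
      ip A (lact (ip A ξ' ξ) η) (x n) := by
    intro r hr
    obtain rfl : r = n := add_left_cancel (hr.trans h.symm)
    rw [X.ip_mul, ip_lact, star_ip]
  rw [DirSum.ip_single_left, DirSum.ip_single_left, creation_apply, dif_pos hmp]
  exact aux _ _

theorem ip_single_creation_of_not_le {m n : Fin k → ℕ} (h : ¬ m ≤ n) (η : E n) (ξ : E m)
    (x : Fock A E) : ip A (DirSum.single A n η) (X.creation ξ x) = 0 := by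
  rw [DirSum.ip_single_left, creation_apply, dif_neg h, ip_zero_right]

end ProductSystem

/-! ### The extension of a representation to all fibres -/

section Extension

variable {A : Type u} [NonUnitalCStarAlgebra A] [PartialOrder A] [StarOrderedRing A]
variable {k : ℕ}
variable {E : (Fin k → ℕ) → Type v} [∀ n, NormedAddCommGroup (E n)] [∀ n, NormedSpace ℂ (E n)]
    [∀ n, SMul Aᵐᵒᵖ (E n)] [∀ n, CStarModule Aᵐᵒᵖ (E n)] [∀ n, Correspondence A (E n)]
variable {H : Type w} [NormedAddCommGroup H] [InnerProductSpace ℂ H] [CompleteSpace H]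

theorem exists_single_add_of_apply_ne_zero {n : Fin k → ℕ} {i : Fin k} (hn : n i ≠ 0) :
    ∃ m, ε i + m = n := by
  refine ⟨n - ε i, add_tsub_cancel_of_le fun j => ?_⟩
  rcases eq_or_ne j i with rfl | hj
  · simpa using Nat.one_le_iff_ne_zero.mpr hn
  · simp [hj]

theorem exists_single_add_of_ne_zero {n : Fin k → ℕ} (hn : n ≠ 0) : ∃ i m, ε i + m = n := by
  obtain ⟨i, hi⟩ := Function.ne_iff.mp hn
  exact ⟨i, exists_single_add_of_apply_ne_zero hi⟩

theorem sum_single_add (i : Fin k) (m : Fin k → ℕ) : ∑ j, (ε i + m) j = 1 + ∑ j, m j := by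
  simp [Finset.sum_add_distrib]

/-- Induction on `ℕ₀^k` along the standard basis vectors. -/
theorem single_add_induction {P : (Fin k → ℕ) → Prop} (zero : P 0)
    (add : ∀ i m, P m → P (ε i + m)) (n : Fin k → ℕ) : P n := by
  induction h : ∑ j, n j using Nat.strong_induction_on generalizing n with
  | _ N ih =>
    rcases eq_or_ne n 0 with rfl | hn
    · exact zero
    · obtain ⟨i, m, rfl⟩ := exists_single_add_of_ne_zero hn
      rw [sum_single_add] at h
      exact add i m (ih _ (by omega) m rfl)

namespace IsometricTuple

variable (R : IsometricTuple A E H)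

theorem inner_T_T (i : Fin k) (ξ η : E (ε i)) (h h' : H) :
    inner ℂ (R.T i ξ h) (R.T i η h') = inner ℂ h (R.σ (ip A ξ η) h') := by
  rw [← R.isometric, ContinuousLinearMap.comp_apply, ContinuousLinearMap.adjoint_inner_right]

theorem inner_σ_left (a : A) (h h' : H) :
    inner ℂ (R.σ a h) h' = inner ℂ h (R.σ (star a) h') := by
  rw [map_star, ContinuousLinearMap.star_eq_adjoint, ContinuousLinearMap.adjoint_inner_right]

/-- An isometric extension of the representation to the fibre `E n`, as an operator
`E n ⊗_σ H → H` intertwining the left actions of `A`. -/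
structure FibreIsometry (n : Fin k → ℕ) where
  /-- The underlying isometry. -/
  toIsometry : IntTensor (E n) R.σ →ₗᵢ[ℂ] H
  /-- The intertwining relation. -/
  map_leftRep : ∀ a u, toIsometry (leftRep (E n) R.σ a u) = R.σ a (toIsometry u)

variable {R} in
theorem FibreIsometry.inner_apply_tm {n : Fin k → ℕ} (V : R.FibreIsometry n) (i : Fin k)
    (ξ ξ' : E (ε i)) (u u' : IntTensor (E n) R.σ) :
    inner ℂ (R.T i ξ (V.toIsometry u)) (R.T i ξ' (V.toIsometry u')) =
      inner ℂ u (leftRep (E n) R.σ (ip A ξ ξ') u') := by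
  rw [inner_T_T, ← V.map_leftRep, LinearIsometry.inner_map_map]

variable {R} in
/-- The maps `ξ ↦ T⁽ⁱ⁾(ξ) V` that the isometry `FibreIsometry.consAux` extends. -/
def FibreIsometry.applyT {m : Fin k → ℕ} (V : R.FibreIsometry m) (i : Fin k) :
    E (ε i) →ₗ[ℂ] (IntTensor (E m) R.σ →L[ℂ] H) where
  toFun ξ := (R.T i ξ).comp V.toIsometry.toContinuousLinearMap
  map_add' ξ η := by rw [map_add, ContinuousLinearMap.add_comp]
  map_smul' c ξ := by rw [map_smul, ContinuousLinearMap.smul_comp]; rfl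

variable {R} in
/-- The isometry `E_i ⊗ (E m ⊗_σ H) → H`, `ξ ⊗ u ↦ T⁽ⁱ⁾(ξ) V u`. -/
def FibreIsometry.consAux {m : Fin k → ℕ} (V : R.FibreIsometry m) (i : Fin k) :
    IntTensor (E (ε i)) (leftRep (E m) R.σ) →ₗᵢ[ℂ] H :=
  liftIsometry (leftRep (E m) R.σ) (V.applyT i)
    fun ξ η u u' => V.inner_apply_tm i ξ η u u'

variable {R} in
theorem FibreIsometry.consAux_tm {m : Fin k → ℕ} (V : R.FibreIsometry m) (i : Fin k)
    (ξ : E (ε i)) (u : IntTensor (E m) R.σ) :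
    V.consAux i (tm (leftRep (E m) R.σ) ξ u) = R.T i ξ (V.toIsometry u) := by
  unfold consAux
  exact liftIsometry_tm (leftRep (E m) R.σ) _ _ ξ u

theorem σ_T (i : Fin k) (a : A) (ξ : E (ε i)) (h : H) :
    R.σ a (R.T i ξ h) = R.T i (lact a ξ) h := by
  rw [T_lact]; rfl

end IsometricTuple

variable (X : ProductSystem A E)

/-- Bounded linear maps on `E p ⊗_σ H` are determined by the elementary tensors `xy ⊗ h`. -/
theorem ProductSystem.intTensor_ext_mul (σ : A →⋆ₙₐ[ℂ] (H →L[ℂ] H)) {m n p : Fin k → ℕ}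
    (hp : m + n = p) {G : Type*} [NormedAddCommGroup G] [NormedSpace ℂ G]
    {f g : IntTensor (E p) σ →L[ℂ] G}
    (hfg : ∀ x y h, f (tm σ (X.mul hp x y) h) = g (tm σ (X.mul hp x y) h)) : f = g := by
  refine intTensor_ext σ fun z h => ?_
  refine eq_of_closedSpan_eq_top (X.dense_mul hp) (f := f.comp (tmL σ h)) (g := g.comp (tmL σ h))
    ?_ z
  rintro _ ⟨x, y, rfl⟩
  exact hfg x y h

theorem ProductSystem.mulUnitary_symm_tm (σ : A →⋆ₙₐ[ℂ] (H →L[ℂ] H)) {m n p : Fin k → ℕ}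
    (hp : m + n = p) (x : E m) (y : E n) (h : H) :
    (X.mulUnitary σ hp).symm (tm σ (X.mul hp x y) h) = tm (leftRep (E n) σ) x (tm σ y h) := by
  rw [LinearIsometryEquiv.symm_apply_eq]
  exact (X.mulIsometry_tm σ hp x y h).symm

namespace IsometricTuple

variable (R : IsometricTuple A E H)

variable {R} in
/-- The extension to the fibre of `ε i + m` obtained from one to the fibre of `m`:
`ξη ⊗ h ↦ T⁽ⁱ⁾(ξ) V (η ⊗ h)`. -/
def FibreIsometry.cons {m n : Fin k → ℕ} (V : R.FibreIsometry m) (i : Fin k) (h : ε i + m = n) :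
    R.FibreIsometry n where
  toIsometry := (V.consAux i).comp (X.mulUnitary R.σ h).symm.toLinearIsometry
  map_leftRep a u := by
    have : ((V.consAux i).comp
        (X.mulUnitary R.σ h).symm.toLinearIsometry).toContinuousLinearMap.comp
        (leftRep (E n) R.σ a) = (R.σ a).comp ((V.consAux i).comp
        (X.mulUnitary R.σ h).symm.toLinearIsometry).toContinuousLinearMap :=
      X.intTensor_ext_mul R.σ h fun x y z => by
        change V.consAux i ((X.mulUnitary R.σ h).symm (leftRep (E n) R.σ a _)) =
          R.σ a (V.consAux i ((X.mulUnitary R.σ h).symm _))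
        rw [leftRep_tm, ← X.mul_lact, X.mulUnitary_symm_tm, X.mulUnitary_symm_tm,
          V.consAux_tm, V.consAux_tm, σ_T]
    exact congrArg (fun F => F u) this

variable {R} in
theorem FibreIsometry.cons_tm {m n : Fin k → ℕ} (V : R.FibreIsometry m) (i : Fin k)
    (h : ε i + m = n) (ξ : E (ε i)) (η : E m) (z : H) :
    (V.cons X i h).toIsometry (tm R.σ (X.mul h ξ η) z) =
      R.T i ξ (V.toIsometry (tm R.σ η z)) := by
  change V.consAux i ((X.mulUnitary R.σ h).symm _) = _
  rw [X.mulUnitary_symm_tm, V.consAux_tm]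

/-- The representation `σ` as a linear map on the fibre `E 0 = A`. -/
def σZero : E 0 →ₗ[ℂ] (H →L[ℂ] H) where
  toFun x := R.σ (X.unit.symm x)
  map_add' x y := by rw [map_add, map_add]
  map_smul' c x := by rw [map_smul, map_smul]; rfl

theorem σZero_unit (a : A) : R.σZero X (X.unit a) = R.σ a :=
  congrArg R.σ (X.unit.symm_apply_apply a)

theorem inner_σZero (x y : E 0) (h h' : H) :
    inner ℂ (R.σZero X x h) (R.σZero X y h') = inner ℂ h (R.σ (ip A x y) h') := by
  obtain ⟨a, rfl⟩ := X.unit.surjective x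
  obtain ⟨b, rfl⟩ := X.unit.surjective y
  rw [σZero_unit, σZero_unit, inner_σ_left, X.ip_unit, map_mul]; rfl

/-- The extension to the fibre `E 0 = A`, given by `a ⊗ h ↦ σ(a) h`. -/
def fibreIsometryZero : R.FibreIsometry 0 where
  toIsometry := liftIsometry R.σ (R.σZero X) (R.inner_σZero X)
  map_leftRep a u := by
    have : (liftIsometry R.σ (R.σZero X) (R.inner_σZero X)).toContinuousLinearMap.comp
        (leftRep (E 0) R.σ a) =
        (R.σ a).comp (liftIsometry R.σ (R.σZero X) (R.inner_σZero X)).toContinuousLinearMap :=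
      intTensor_ext R.σ fun x h => by
        obtain ⟨b, rfl⟩ := X.unit.surjective x
        simp only [ContinuousLinearMap.comp_apply, LinearIsometry.coe_toContinuousLinearMap]
        rw [leftRep_tm, liftIsometry_tm, liftIsometry_tm, X.lact_unit, σZero_unit, σZero_unit,
          map_mul]
        rfl
    exact congrArg (fun F => F u) this

theorem fibreIsometryZero_tm (a : A) (h : H) :
    (R.fibreIsometryZero X).toIsometry (tm R.σ (X.unit a) h) = R.σ a h := by
  rw [fibreIsometryZero, liftIsometry_tm, σZero_unit]

/-- The extension to the fibre `E n`, defined by splitting off an arbitrarily chosen basis vector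
from `n` at each step; `IsometricRep.ext_mul` shows that the choice does not matter. -/
def fibreIsometry (n : Fin k → ℕ) : R.FibreIsometry n :=
  if hn : n = 0 then hn ▸ R.fibreIsometryZero X
  else
    have h := (exists_single_add_of_ne_zero hn).choose_spec.choose_spec
    (fibreIsometry (exists_single_add_of_ne_zero hn).choose_spec.choose).cons X _ h
termination_by ∑ j, n j
decreasing_by
  conv_rhs => rw [← (exists_single_add_of_ne_zero hn).choose_spec.choose_spec, sum_single_add]
  exact Nat.lt_one_add_iff.mpr le_rfl

theorem fibreIsometry_zero : R.fibreIsometry X 0 = R.fibreIsometryZero X := by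
  rw [fibreIsometry, dif_pos rfl]

theorem fibreIsometry_eq_cons {n : Fin k → ℕ} (hn : n ≠ 0) :
    ∃ (i : Fin k) (m : Fin k → ℕ) (h : ε i + m = n),
      R.fibreIsometry X n = (R.fibreIsometry X m).cons X i h :=
  ⟨_, _, (exists_single_add_of_ne_zero hn).choose_spec.choose_spec, by
    rw [fibreIsometry, dif_neg hn]⟩

end IsometricTuple

namespace IsometricRep

variable {X}
variable (R : IsometricRep X H)

/-- The extension of the representation to the fibre `E n`, written as a function `T_n(ξ) h` of two
variables: the value of the isometry `fibreIsometry` at `ξ ⊗ h`. -/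
def ext (n : Fin k → ℕ) (ξ : E n) (h : H) : H :=
  (R.fibreIsometry X n).toIsometry (tm R.σ ξ h)

theorem inner_ext (n : Fin k → ℕ) (ξ η : E n) (h h' : H) :
    inner ℂ (R.ext n ξ h) (R.ext n η h') = inner ℂ h (R.σ (ip A ξ η) h') := by
  rw [ext, ext, LinearIsometry.inner_map_map, inner_tm]

theorem σ_ext (n : Fin k → ℕ) (a : A) (ξ : E n) (h : H) :
    R.σ a (R.ext n ξ h) = R.ext n (lact a ξ) h := by
  rw [ext, ext, ← leftRep_tm, (R.fibreIsometry X n).map_leftRep]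

theorem ext_zero (a : A) (h : H) : R.ext 0 (X.unit a) h = R.σ a h := by
  rw [ext, R.fibreIsometry_zero X, R.fibreIsometryZero_tm]

/-- The bounded linear map `ξ ↦ T_n(ξ) h`. -/
def extL (n : Fin k → ℕ) (h : H) : E n →L[ℂ] H :=
  (R.fibreIsometry X n).toIsometry.toContinuousLinearMap.comp (tmL R.σ h)

@[simp] theorem extL_apply (n : Fin k → ℕ) (h : H) (ξ : E n) : R.extL n h ξ = R.ext n ξ h := rfl

/-- A closed subspace contains `S T_p(z) h` for all `z` once it does for the products `z = xy`. -/
theorem ext_mem_of_mul {m n p : Fin k → ℕ} (hp : m + n = p) {M : Submodule ℂ H}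
    (hM : IsClosed (M : Set H)) {h : H} (S : H →L[ℂ] H)
    (hmul : ∀ (x : E m) (y : E n), S (R.ext p (X.mul hp x y) h) ∈ M) (z : E p) :
    S (R.ext p z h) ∈ M :=
  map_mem_of_closedSpan_eq_top (X.dense_mul hp) hM (S.comp (R.extL p h))
    (by rintro _ ⟨x, y, rfl⟩; exact hmul x y) z

/-- `T_p(xy) h` is bounded in `x`. -/
theorem exists_ext_mul_left {m n p : Fin k → ℕ} (hp : m + n = p) (y : E n) (h : H) :
    ∃ f : E m →L[ℂ] H, ∀ x, f x = R.ext p (X.mul hp x y) h :=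
  ⟨((R.fibreIsometry X p).toIsometry.toContinuousLinearMap.comp
    (X.mulIsometry R.σ hp).toContinuousLinearMap).comp (tmL (leftRep (E n) R.σ) (tm R.σ y h)),
    fun x => congrArg (R.fibreIsometry X p).toIsometry (X.mulIsometry_tm R.σ hp x y h)⟩

/-- `T_p(xy) h` is bounded in `y`. -/
theorem exists_ext_mul_right {m n p : Fin k → ℕ} (hp : m + n = p) (x : E m) (h : H) :
    ∃ f : E n →L[ℂ] H, ∀ y, f y = R.ext p (X.mul hp x y) h :=
  ⟨((R.fibreIsometry X p).toIsometry.toContinuousLinearMap.comp (X.mulOp R.σ hp x)).comp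
    (tmL R.σ h), fun y => congrArg (R.fibreIsometry X p).toIsometry (X.mulOp_tm R.σ hp x y h)⟩

/-- The operator `E (ε i + ε j) ⊗_σ H → H`, `ξη ⊗ h ↦ T⁽ⁱ⁾(ξ) T⁽ʲ⁾(η) h`. -/
def pairOp {i j : Fin k} {p : Fin k → ℕ} (hp : ε i + ε j = p) : IntTensor (E p) R.σ →L[ℂ] H :=
  ((R.TtildeL i).comp (R.ampTtilde i j)).comp
    (X.mulUnitary R.σ hp).symm.toContinuousLinearEquiv.toContinuousLinearMap

theorem pairOp_mul {i j : Fin k} {p : Fin k → ℕ} (hp : ε i + ε j = p) (ξ : E (ε i)) (η : E (ε j))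
    (h : H) : R.pairOp hp (tm R.σ (X.mul hp ξ η) h) = R.T i ξ (R.T j η h) := by
  change R.Ttilde i (R.ampTtilde i j ((X.mulUnitary R.σ hp).symm _)) = _
  rw [X.mulUnitary_symm_tm, IsometricTuple.ampTtilde, ampR_tm, IsometricTuple.Ttilde_tm]
  change R.T i ξ (R.Ttilde j _) = _
  rw [IsometricTuple.Ttilde_tm]

theorem pairOp_comm {i j : Fin k} {p : Fin k → ℕ} (hp : ε i + ε j = p) (hp' : ε j + ε i = p) :
    R.pairOp hp = R.pairOp hp' := by
  subst hp
  refine ContinuousLinearMap.ext fun u => ?_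
  have := congrArg (fun F => F ((X.mulUnitary R.σ rfl).symm u)) (R.comm i j)
  refine this.trans ?_
  change R.Ttilde j (R.ampTtilde j i ((X.mulUnitary R.σ _).symm
    ((X.mulUnitary R.σ rfl) ((X.mulUnitary R.σ rfl).symm u)))) = _
  rw [LinearIsometryEquiv.apply_symm_apply]
  rfl

theorem pairOp_mul_swap {i j : Fin k} {p : Fin k → ℕ} (hp : ε i + ε j = p) (hp' : ε j + ε i = p)
    (ξ : E (ε i)) (η : E (ε j)) (h : H) :
    R.pairOp hp (tm R.σ (X.mul hp' η ξ) h) = R.T j η (R.T i ξ h) := by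
  rw [R.pairOp_comm hp hp', pairOp_mul]

/-- The extensions to all fibres form a representation of the product system:
`T_{ε i + m}(ξη) = T⁽ⁱ⁾(ξ) T_m(η)` for every `i`, and not just for the one used to define the
left-hand side. -/
theorem ext_mul (i : Fin k) {m n : Fin k → ℕ} (hn : ε i + m = n) (ξ : E (ε i)) (η : E m) (h : H) :
    R.ext n (X.mul hn ξ η) h = R.T i ξ (R.ext m η h) := by
  induction hN : ∑ j, n j using Nat.strong_induction_on generalizing n m i with
  | _ N ih =>
    have hn0 : n ≠ 0 := by
      rintro rfl
      have := sum_single_add i m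
      rw [hn] at this
      simp only [Pi.zero_apply, Finset.sum_const_zero] at this
      omega
    obtain ⟨j, m', hj, hc⟩ := R.fibreIsometry_eq_cons X hn0
    have hchosen : ∀ (x : E (ε j)) (y : E m'),
        R.ext n (X.mul hj x y) h = R.T j x (R.ext m' y h) := fun x y => by
      rw [ext, hc, IsometricTuple.FibreIsometry.cons_tm]; rfl
    rcases eq_or_ne i j with rfl | hij
    · obtain rfl : m' = m := add_left_cancel (hj.trans hn.symm)
      exact hchosen ξ η
    -- Both `m` and `m'` contain the common part `q = n - ε i - ε j`.
    have hmj : m j ≠ 0 := by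
      have := congrFun (hn.trans hj.symm) j
      simp only [Pi.add_apply, Pi.single_eq_same, Pi.single_eq_of_ne hij.symm] at this
      omega
    obtain ⟨q, rfl⟩ := exists_single_add_of_apply_ne_zero hmj
    obtain rfl : m' = ε i + q := by
      refine add_left_cancel (a := ε j) ?_
      rw [hj, ← hn, add_left_comm]
    have hsum := sum_single_add i (ε j + q)
    rw [hn, hN] at hsum
    have hsum' := sum_single_add j (ε i + q)
    rw [hj, hN] at hsum'
    have ihj : ∀ (y : E (ε j)) (z : E q), R.ext _ (X.mul rfl y z) h = R.T j y (R.ext q z h) :=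
      fun y z => ih _ (by omega) j rfl y z rfl
    have ihi : ∀ (x : E (ε i)) (z : E q), R.ext _ (X.mul rfl x z) h = R.T i x (R.ext q z h) :=
      fun x z => ih _ (by omega) i rfl x z rfl
    have hpq : ε i + ε j + q = n := (add_assoc _ _ _).trans hn
    have hp' : ε j + ε i = ε i + ε j := add_comm _ _
    -- Both sides below are continuous in `x ∈ E (ε i + ε j)`, hence determined by the products
    -- `x = y' x'` with `y' ∈ E_j`, `x' ∈ E_i`, for which the chosen factorisation of `n` applies.
    have key : ∀ (x : E (ε i + ε j)) (z : E q),
        R.ext n (X.mul hpq x z) h = R.pairOp rfl (tm R.σ x (R.ext q z h)) := by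
      intro x z
      obtain ⟨f, hf⟩ := R.exists_ext_mul_left hpq z h
      rw [← hf]
      refine eq_of_closedSpan_eq_top (X.dense_mul hp') (f := f)
        (g := (R.pairOp rfl).comp (tmL R.σ (R.ext q z h))) ?_ x
      rintro _ ⟨y', x', rfl⟩
      rw [hf, ContinuousLinearMap.comp_apply, tmL_apply, R.pairOp_mul_swap,
        X.mul_assoc hp' hpq rfl hj, hchosen, ihi]
    obtain ⟨f, hf⟩ := R.exists_ext_mul_right hn ξ h
    rw [← hf]
    refine eq_of_closedSpan_eq_top (X.dense_mul (rfl : ε j + q = ε j + q)) (f := f)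
      (g := (R.T i ξ).comp (R.extL _ h)) ?_ η
    rintro _ ⟨y, z, rfl⟩
    rw [hf, ContinuousLinearMap.comp_apply, extL_apply, ihj, ← X.mul_assoc rfl hpq rfl hn, key,
      R.pairOp_mul]

end IsometricRep
end Extension

/-! ### Wandering subspaces -/

section Wandering

open ContinuousLinearMap (adjoint)

variable {A : Type u} [NonUnitalCStarAlgebra A] [PartialOrder A] [StarOrderedRing A]
variable {k : ℕ}
variable {E : (Fin k → ℕ) → Type v} [∀ n, NormedAddCommGroup (E n)] [∀ n, NormedSpace ℂ (E n)]
    [∀ n, SMul Aᵐᵒᵖ (E n)] [∀ n, CStarModule Aᵐᵒᵖ (E n)] [∀ n, Correspondence A (E n)]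
variable {H : Type w} [NormedAddCommGroup H] [InnerProductSpace ℂ H] [CompleteSpace H]

namespace IsometricTuple

variable (R : IsometricTuple A E H)

/-- The wandering subspace of `T⁽ⁱ⁾`: the common kernel of the operators `T⁽ⁱ⁾(ξ)^*`, i.e. the
orthogonal complement of the range of `T̃⁽ⁱ⁾`. -/
def wandering (i : Fin k) : Submodule ℂ H := ⨅ ξ : E (ε i), (adjoint (R.T i ξ)).toLinearMap.ker

theorem mem_wandering {i : Fin k} {h : H} : h ∈ R.wandering i ↔ ∀ ξ, adjoint (R.T i ξ) h = 0 := by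
  simp [wandering, Submodule.mem_iInf]

theorem mem_wandering_iff_inner {i : Fin k} {h : H} :
    h ∈ R.wandering i ↔ ∀ ξ x, inner ℂ (R.T i ξ x) h = 0 := by
  rw [mem_wandering]
  refine forall_congr' fun ξ => ⟨fun h0 x => ?_, fun h0 => ?_⟩
  · rw [← ContinuousLinearMap.adjoint_inner_right, h0, inner_zero_right]
  · refine ext_inner_left ℂ fun x => ?_
    rw [ContinuousLinearMap.adjoint_inner_right, h0, inner_zero_right]

theorem isClosed_wandering (i : Fin k) : IsClosed (R.wandering i : Set H) := by
  rw [wandering, Submodule.coe_iInf]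
  exact isClosed_iInter fun ξ => (adjoint (R.T i ξ)).isClosed_ker

theorem mem_wandering_iff_adjoint_Ttilde {i : Fin k} {h : H} :
    h ∈ R.wandering i ↔ adjoint (R.TtildeL i) h = 0 := by
  have hT : ∀ ξ x, inner ℂ (R.T i ξ x) h = inner ℂ (tm R.σ ξ x) (adjoint (R.TtildeL i) h) := by
    intro ξ x
    rw [ContinuousLinearMap.adjoint_inner_right, LinearIsometry.coe_toContinuousLinearMap,
      Ttilde_tm]
  rw [mem_wandering_iff_inner]
  refine ⟨fun h0 => ?_, fun h0 ξ x => by rw [hT, h0, inner_zero_right]⟩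
  have h1 : innerSL ℂ (adjoint (R.TtildeL i) h) = 0 := intTensor_ext R.σ fun ξ x => by
    rw [innerSL_apply_apply, ← inner_conj_symm, ← hT, h0, map_zero]; rfl
  have h2 := congrArg (fun F => F (adjoint (R.TtildeL i) h)) h1
  simpa using h2

theorem σ_mem_wandering {i : Fin k} {h : H} (hh : h ∈ R.wandering i) (a : A) :
    R.σ a h ∈ R.wandering i := by
  rw [mem_wandering_iff_inner] at hh ⊢
  intro ξ x
  rw [← star_star a, ← R.inner_σ_left, σ_T]
  exact hh _ _

/-- The joint wandering subspace `⋂ ker T̃⁽ⁱ⁾^*`, on which the inducing representation acts. -/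
def jointWandering : Submodule ℂ H := ⨅ i, R.wandering i

theorem mem_jointWandering {h : H} : h ∈ R.jointWandering ↔ ∀ i, h ∈ R.wandering i :=
  Submodule.mem_iInf _

theorem isClosed_jointWandering : IsClosed (R.jointWandering : Set H) := by
  rw [jointWandering, Submodule.coe_iInf]
  exact isClosed_iInter R.isClosed_wandering

theorem σ_mem_jointWandering {h : H} (hh : h ∈ R.jointWandering) (a : A) :
    R.σ a h ∈ R.jointWandering :=
  R.mem_jointWandering.mpr fun i => R.σ_mem_wandering (R.mem_jointWandering.mp hh i) a

theorem eq_zero_of_inner_σ {h : H} (h0 : ∀ a x, inner ℂ (R.σ a x) h = 0) : h = 0 := by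
  have h1 : innerSL ℂ h = 0 := R.nondegenerate.ext fun a x => by
    rw [innerSL_apply_apply, ← inner_conj_symm, h0, map_zero]; rfl
  have h2 := congrArg (fun F => F h) h1
  simpa using h2

/-- A vector of a `σ`-invariant subspace that is orthogonal to `σ(A)` applied to that subspace
vanishes: since `σ(a)^* h` lies in the subspace, `‖σ(a)^* h‖² = ⟨σ(a) σ(a)^* h, h⟩ = 0`. -/
theorem eq_zero_of_inner_σ_of_mem {L : Submodule ℂ H} (hL : ∀ a, ∀ x ∈ L, R.σ a x ∈ L) {h : H}
    (hh : h ∈ L) (h0 : ∀ a, ∀ x ∈ L, inner ℂ (R.σ a x) h = 0) : h = 0 := by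
  refine R.eq_zero_of_inner_σ fun a x => ?_
  have : R.σ (star a) h = 0 := by
    rw [← inner_self_eq_zero (𝕜 := ℂ), ← R.inner_σ_left]
    exact h0 a _ (hL _ _ hh)
  rw [R.inner_σ_left, this, inner_zero_right]

theorem T_mem_rangeSubspace {i : Fin k} {l : ℕ} (ξ : E (ε i)) {h : H}
    (hh : h ∈ R.rangeSubspace i l) : R.T i ξ h ∈ R.rangeSubspace i (l + 1) := by
  refine map_mem_of_mem_closedSpan (Submodule.isClosed_topologicalClosure _) (R.T i ξ) ?_ hh
  rintro _ ⟨η, x, rfl⟩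
  refine Submodule.le_topologicalClosure _ (Submodule.subset_span ⟨Fin.cons ξ η, x, ?_⟩)
  rw [List.ofFn_succ, List.prod_cons]
  simp only [Fin.cons_zero, Fin.cons_succ]
  rfl

theorem mem_rangeSubspace_zero (i : Fin k) (h : H) : h ∈ R.rangeSubspace i 0 :=
  Submodule.le_topologicalClosure _ (Submodule.subset_span ⟨Fin.elim0, h, by simp⟩)

theorem Pinf_eq_zero_iff (i : Fin k) :
    R.Pinf i = 0 ↔ ∀ h, (∀ l, h ∈ R.rangeSubspace i l) → h = 0 := by
  constructor
  · intro h0 h hh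
    have := Submodule.starProjection_eq_self_iff.mpr ((Submodule.mem_iInf _).mpr hh)
    rw [← this]
    exact congrArg (fun F => F h) h0
  · intro h0
    refine ContinuousLinearMap.ext fun h => h0 _ ((Submodule.mem_iInf _).mp ?_)
    exact Submodule.starProjection_apply_mem _ _

/-- A closed subspace that reduces `T⁽ⁱ⁾` and meets its wandering subspace trivially is the closed
span of `T⁽ⁱ⁾(E_i)` applied to itself, and hence lies in the range of every power of `T⁽ⁱ⁾`. -/
theorem mem_rangeSubspace_of_reducing {i : Fin k} {L : Submodule ℂ H}
    (hT : ∀ ξ, ∀ h ∈ L, R.T i ξ h ∈ L) (hT' : ∀ ξ, ∀ h ∈ L, adjoint (R.T i ξ) h ∈ L)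
    (hL : IsClosed (L : Set H)) (h0 : ∀ h ∈ L, h ∈ R.wandering i → h = 0) (l : ℕ) :
    ∀ h ∈ L, h ∈ R.rangeSubspace i l := by
  set L' := (Submodule.span ℂ {z : H | ∃ ξ, ∃ x ∈ L, R.T i ξ x = z}).topologicalClosure with hL'
  have hcl : IsClosed (L' : Set H) := Submodule.isClosed_topologicalClosure _
  have : CompleteSpace L' := hcl.completeSpace_coe
  have hgen : ∀ ξ, ∀ x ∈ L, R.T i ξ x ∈ L' := fun ξ x hx =>
    Submodule.le_topologicalClosure _ (Submodule.subset_span ⟨ξ, x, hx, rfl⟩)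
  have hle : L' ≤ L := Submodule.topologicalClosure_minimal _ (Submodule.span_le.mpr (by
    rintro _ ⟨ξ, x, hx, rfl⟩; exact hT ξ x hx)) hL
  have hge : L ≤ L' := by
    intro h hh
    have hq : h - L'.starProjection h ∈ L :=
      sub_mem hh (hle (Submodule.starProjection_apply_mem _ _))
    have horth : ∀ x ∈ L', inner ℂ x (h - L'.starProjection h) = 0 :=
      (Submodule.mem_orthogonal _ _).mp (Submodule.sub_starProjection_mem_orthogonal h)
    have hz := h0 _ hq (R.mem_wandering.mpr fun ξ => by
      rw [← inner_self_eq_zero (𝕜 := ℂ), ContinuousLinearMap.adjoint_inner_right]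
      exact horth _ (hgen _ _ (hT' _ _ hq)))
    rw [sub_eq_zero.mp hz]
    exact Submodule.starProjection_apply_mem _ _
  induction l with
  | zero => exact fun h _ => R.mem_rangeSubspace_zero i h
  | succ l ih =>
    have : L' ≤ R.rangeSubspace i (l + 1) :=
      Submodule.topologicalClosure_minimal _ (Submodule.span_le.mpr (by
        rintro _ ⟨ξ, x, hx, rfl⟩
        exact R.T_mem_rangeSubspace ξ (ih x hx))) (Submodule.isClosed_topologicalClosure _)
    exact fun h hh => this (hge hh)

end IsometricTuple

namespace IsometricRep

variable {X : ProductSystem A E} (R : IsometricRep X H)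

/-- For `j ≠ i` the operators `T⁽ʲ⁾(ξ)` preserve the wandering subspace of `T⁽ⁱ⁾`. This is where
double commutation enters. -/
theorem DoublyCommuting.T_mem_wandering {R : IsometricRep X H} (hR : R.DoublyCommuting)
    {i j : Fin k} (hij : j ≠ i) {h : H} (hh : h ∈ R.wandering i) (ξ : E (ε j)) :
    R.T j ξ h ∈ R.wandering i := by
  rw [IsometricTuple.mem_wandering_iff_adjoint_Ttilde] at hh ⊢
  have h1 := congrArg (fun F => F (tm R.σ ξ h)) (hR j i hij)
  have h2 : R.ampTtildeAdjoint j i (tm R.σ ξ h) = 0 := by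
    rw [IsometricTuple.ampTtildeAdjoint, ampR_tm, hh]
    have := tm_add_right (leftRep (E (ε i)) R.σ) ξ 0 0
    rwa [add_zero, left_eq_add] at this
  change adjoint (R.TtildeL i) (R.Ttilde j (tm R.σ ξ h)) =
    R.ampTtilde i j (X.flip R.σ j i (R.ampTtildeAdjoint j i (tm R.σ ξ h))) at h1
  rwa [h2, map_zero, map_zero, IsometricTuple.Ttilde_tm] at h1

theorem ext_inner_eq_zero_of_mul {m n p : Fin k → ℕ} (hp : m + n = p) {h v : H}
    (hmul : ∀ (x : E m) (y : E n), inner ℂ v (R.ext p (X.mul hp x y) h) = 0) (z : E p) :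
    inner ℂ v (R.ext p z h) = 0 := by
  rw [← Submodule.mem_orthogonal_singleton_iff_inner_right]
  refine R.ext_mem_of_mul hp (Submodule.isClosed_orthogonal _) (ContinuousLinearMap.id ℂ H) ?_ z
  intro x y
  rw [Submodule.mem_orthogonal_singleton_iff_inner_right]
  exact hmul x y

/-- The adjoints `T⁽ʲ⁾(ξ)^*` preserve the wandering subspaces, because
`T⁽ʲ⁾(ξ) T⁽ⁱ⁾(η)` maps into the range of `T̃⁽ⁱ⁾` by the commutation relation. -/
theorem adjoint_T_mem_wandering {i j : Fin k} {h : H} (hh : h ∈ R.wandering i) (ξ : E (ε j)) :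
    adjoint (R.T j ξ) h ∈ R.wandering i := by
  rw [IsometricTuple.mem_wandering_iff_inner] at hh ⊢
  intro η x
  rw [ContinuousLinearMap.adjoint_inner_right, ← R.pairOp_mul rfl]
  have := eq_of_closedSpan_eq_top (X.dense_mul (add_comm (ε i) (ε j)))
    (f := (innerSL ℂ h).comp ((R.pairOp (rfl : ε j + ε i = _)).comp (tmL R.σ x))) (g := 0) (by
      rintro _ ⟨η', ξ', rfl⟩
      change inner ℂ h (R.pairOp rfl (tm R.σ _ x)) = 0
      rw [R.pairOp_mul_swap, ← inner_conj_symm, hh, map_zero]) (X.mul rfl ξ η)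
  change inner ℂ h (R.pairOp rfl (tm R.σ _ x)) = 0 at this
  rw [← inner_conj_symm, this, map_zero]

theorem DoublyCommuting.ext_mem_wandering {R : IsometricRep X H} (hR : R.DoublyCommuting)
    {i : Fin k} {h : H} (hh : h ∈ R.wandering i) (n : Fin k → ℕ) (hn : n i = 0) (ξ : E n) :
    R.ext n ξ h ∈ R.wandering i := by
  induction n using single_add_induction with
  | zero =>
    obtain ⟨a, rfl⟩ := X.unit.surjective ξ
    rw [R.ext_zero]
    exact R.σ_mem_wandering hh a
  | add j m ih =>
    have hji : j ≠ i := by rintro rfl; simp at hn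
    have hm : m i = 0 := by simp only [Pi.add_apply] at hn; omega
    refine R.ext_mem_of_mul rfl (R.isClosed_wandering i) (ContinuousLinearMap.id ℂ H) ?_ ξ
    intro x y
    rw [ContinuousLinearMap.id_apply, R.ext_mul]
    exact hR.T_mem_wandering hji (ih hm y) x

/-- Splitting off `ε i` from both indices reduces the claim to `n i = 0`, where `T_n(η) h'` lies in
the wandering subspace of `T⁽ⁱ⁾` and `T_m(ξ) h` in the range of `T̃⁽ⁱ⁾`. -/
theorem DoublyCommuting.inner_ext_of_lt {R : IsometricRep X H} (hR : R.DoublyCommuting)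
    {i : Fin k} {m n : Fin k → ℕ} (hmn : n i < m i) (ξ : E m) (η : E n) (h : H) {h' : H}
    (hh' : h' ∈ R.wandering i) : inner ℂ (R.ext n η h') (R.ext m ξ h) = 0 := by
  obtain ⟨m', rfl⟩ := exists_single_add_of_apply_ne_zero (n := m) (i := i) (by omega)
  induction ht : n i generalizing m' n with
  | zero =>
    refine R.ext_inner_eq_zero_of_mul rfl (fun x y => ?_) ξ
    rw [R.ext_mul, ← inner_conj_symm,
      R.mem_wandering_iff_inner.mp (hR.ext_mem_wandering hh' n ht η), map_zero]
  | succ t ih =>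
    obtain ⟨n', rfl⟩ := exists_single_add_of_apply_ne_zero (n := n) (i := i) (by omega)
    simp only [Pi.add_apply, Pi.single_eq_same] at ht hmn
    obtain ⟨m'', rfl⟩ := exists_single_add_of_apply_ne_zero (n := m') (i := i) (by omega)
    refine R.ext_inner_eq_zero_of_mul rfl (fun x y => ?_) ξ
    rw [← inner_conj_symm]
    rw [R.ext_inner_eq_zero_of_mul rfl (fun x' y' => ?_) η, map_zero]
    rw [R.ext_mul, R.ext_mul, ← inner_conj_symm, R.inner_T_T, R.σ_ext]
    rw [ih _ m'' (by simp only [Pi.add_apply, Pi.single_eq_same] at hmn ⊢; omega) _ (by omega),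
      map_zero]

/-- On the joint wandering subspace, vectors coming from different fibres are orthogonal. -/
theorem DoublyCommuting.inner_ext_of_ne {R : IsometricRep X H} (hR : R.DoublyCommuting)
    {m n : Fin k → ℕ} (hmn : m ≠ n) (ξ : E m) (η : E n) {h h' : H}
    (hh : h ∈ R.jointWandering) (hh' : h' ∈ R.jointWandering) :
    inner ℂ (R.ext m ξ h) (R.ext n η h') = 0 := by
  obtain ⟨i, hi⟩ := Function.ne_iff.mp hmn
  rcases lt_or_gt_of_ne hi with hlt | hlt
  · exact hR.inner_ext_of_lt hlt η ξ h' (R.mem_jointWandering.mp hh i)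
  · rw [← inner_conj_symm, hR.inner_ext_of_lt hlt ξ η h (R.mem_jointWandering.mp hh' i), map_zero]

/-- The vectors `T_n(ξ) h` with `h` in the joint wandering subspace. -/
def generators : Set H := {z | ∃ n, ∃ ξ : E n, ∃ h ∈ R.jointWandering, R.ext n ξ h = z}

/-- The closed subspace generated by the joint wandering subspace. -/
def generated : Submodule ℂ H := (Submodule.span ℂ R.generators).topologicalClosure

theorem isClosed_generated : IsClosed (R.generated : Set H) :=
  Submodule.isClosed_topologicalClosure _

theorem ext_mem_generated {n : Fin k → ℕ} (ξ : E n) {h : H} (hh : h ∈ R.jointWandering) :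
    R.ext n ξ h ∈ R.generated :=
  Submodule.le_topologicalClosure _ (Submodule.subset_span ⟨n, ξ, h, hh, rfl⟩)

theorem T_mem_generated (i : Fin k) (ξ : E (ε i)) {h : H} (hh : h ∈ R.generated) :
    R.T i ξ h ∈ R.generated := by
  refine map_mem_of_mem_closedSpan R.isClosed_generated (R.T i ξ) ?_ hh
  rintro _ ⟨n, η, x, hx, rfl⟩
  rw [← R.ext_mul i rfl]
  exact R.ext_mem_generated _ hx

theorem DoublyCommuting.adjoint_T_mem_generated {R : IsometricRep X H} (hR : R.DoublyCommuting)
    (i : Fin k) (ξ : E (ε i)) {h : H} (hh : h ∈ R.generated) :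
    adjoint (R.T i ξ) h ∈ R.generated := by
  refine map_mem_of_mem_closedSpan R.isClosed_generated (adjoint (R.T i ξ)) ?_ hh
  rintro _ ⟨n, η, x, hx, rfl⟩
  rcases eq_or_ne (n i) 0 with hn | hn
  · rw [R.mem_wandering.mp (hR.ext_mem_wandering (R.mem_jointWandering.mp hx i) n hn η)]
    exact zero_mem _
  · obtain ⟨m, rfl⟩ := exists_single_add_of_apply_ne_zero hn
    refine R.ext_mem_of_mul rfl R.isClosed_generated (adjoint (R.T i ξ)) (fun y z => ?_) η
    rw [R.ext_mul, ← ContinuousLinearMap.comp_apply, R.isometric, R.σ_ext]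
    exact R.ext_mem_generated _ hx

/-- If all `P^i_∞` vanish, then the joint wandering subspace generates `H`. The complement of the
generated subspace reduces all `T⁽ⁱ⁾` and meets the joint wandering subspace trivially. One
index at a time, its intersections with `⋂_{i ∉ t} ker T̃⁽ⁱ⁾^*` are shown to vanish for larger and
larger `t`. -/
theorem DoublyCommuting.generated_eq_top {R : IsometricRep X H} (hR : R.DoublyCommuting)
    (hP : ∀ i, R.Pinf i = 0) : R.generated = ⊤ := by
  have hT : ∀ i ξ, ∀ h ∈ R.generatedᗮ, R.T i ξ h ∈ R.generatedᗮ := fun i ξ h hh => by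
    rw [Submodule.mem_orthogonal] at hh ⊢
    intro x hx
    rw [← ContinuousLinearMap.adjoint_inner_left]
    exact hh _ (hR.adjoint_T_mem_generated i ξ hx)
  have hT' : ∀ i ξ, ∀ h ∈ R.generatedᗮ, adjoint (R.T i ξ) h ∈ R.generatedᗮ := fun i ξ h hh => by
    rw [Submodule.mem_orthogonal] at hh ⊢
    intro x hx
    rw [ContinuousLinearMap.adjoint_inner_right]
    exact hh _ (R.T_mem_generated i ξ hx)
  have key : ∀ t : Finset (Fin k), ∀ h ∈ R.generatedᗮ, (∀ i, i ∉ t → h ∈ R.wandering i) →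
      h = 0 := by
    intro t
    induction t using Finset.induction_on with
    | empty =>
      intro h hh hw
      have hhK : h ∈ R.jointWandering := R.mem_jointWandering.mpr fun i => hw i (by simp)
      refine R.eq_zero_of_inner_σ_of_mem (fun a x hx => R.σ_mem_jointWandering hx a) hhK ?_
      intro a x hx
      rw [← R.ext_zero]
      exact (Submodule.mem_orthogonal _ _).mp hh _ (R.ext_mem_generated _ hx)
    | insert j t hj ih =>
      let L : Submodule ℂ H := R.generatedᗮ ⊓ ⨅ i, ⨅ (_ : i ∉ insert j t), R.wandering i
      have hmem : ∀ h, h ∈ L ↔ h ∈ R.generatedᗮ ∧ ∀ i, i ∉ insert j t → h ∈ R.wandering i := by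
        intro h
        simp only [L, Submodule.mem_inf, Submodule.mem_iInf]
      have hL : IsClosed (L : Set H) := by
        simp only [L, Submodule.coe_inf, Submodule.coe_iInf]
        exact (Submodule.isClosed_orthogonal _).inter
          (isClosed_iInter fun i => isClosed_iInter fun _ => R.isClosed_wandering i)
      have hLr := R.mem_rangeSubspace_of_reducing (i := j) (L := L)
        (fun ξ h hh => (hmem _).mpr ⟨hT j ξ h ((hmem h).mp hh).1, fun i hi =>
          hR.T_mem_wandering (fun e => hi (by simp [e])) (((hmem h).mp hh).2 i hi) ξ⟩)
        (fun ξ h hh => (hmem _).mpr ⟨hT' j ξ h ((hmem h).mp hh).1, fun i hi =>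
          R.adjoint_T_mem_wandering (((hmem h).mp hh).2 i hi) ξ⟩)
        hL (fun h hh hw => ih h ((hmem h).mp hh).1 fun i hi => by
          rcases eq_or_ne i j with rfl | hij
          · exact hw
          · exact ((hmem h).mp hh).2 i (by simp [hij, hi]))
      intro h hh hw
      exact (R.Pinf_eq_zero_iff j).mp (hP j) h fun l => hLr l h ((hmem h).mpr ⟨hh, hw⟩)
  have : CompleteSpace R.generated := R.isClosed_generated.completeSpace_coe
  rw [← Submodule.orthogonal_eq_bot_iff, Submodule.eq_bot_iff]
  exact fun h hh => key Finset.univ h hh fun i hi => absurd (Finset.mem_univ i) hi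

end IsometricRep
end Wandering

/-! ### Induced representations and the two implications -/

section Wold

open ContinuousLinearMap (adjoint)

variable {A : Type u} [NonUnitalCStarAlgebra A] [PartialOrder A] [StarOrderedRing A]
variable {k : ℕ}
variable {E : (Fin k → ℕ) → Type v} [∀ n, NormedAddCommGroup (E n)] [∀ n, NormedSpace ℂ (E n)]
    [∀ n, SMul Aᵐᵒᵖ (E n)] [∀ n, CStarModule Aᵐᵒᵖ (E n)] [∀ n, Correspondence A (E n)]
variable (X : ProductSystem A E)

section Induced

variable {K : Type w} [NormedAddCommGroup K] [InnerProductSpace ℂ K] [CompleteSpace K]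
variable (π : A →⋆ₙₐ[ℂ] (K →L[ℂ] K))

theorem ProductSystem.induced_T_tm (i : Fin k) (ξ : E (ε i)) (x : Fock A E) (h : K) :
    (X.induced π).T i ξ (tm π x h) = tm π (X.creation ξ x) h :=
  ampL_tm π (X.creation ξ) ‖ξ‖ (X.creation_op_smul ξ) (X.creation_bound ξ) x h

variable (E) in
/-- The closed subspace of `F(𝔼) ⊗_π K` of vectors whose components at the indices `n` with
`n i < l` vanish. -/
def fockTail (i : Fin k) (l : ℕ) : Submodule ℂ (IntTensor (Fock A E) π) where
  carrier := {u | ∀ (n : Fin k → ℕ), n i < l → ∀ (η : E n) (h : K),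
    inner ℂ (tm π (DirSum.single A n η) h) u = 0}
  zero_mem' n _ η h := inner_zero_right _
  add_mem' hu hv n hn η h := by rw [inner_add_right, hu n hn, hv n hn, add_zero]
  smul_mem' c u hu n hn η h := by rw [inner_smul_right, hu n hn, mul_zero]

theorem isClosed_fockTail (i : Fin k) (l : ℕ) :
    IsClosed (fockTail E π i l : Set (IntTensor (Fock A E) π)) := by
  have : (fockTail E π i l : Set (IntTensor (Fock A E) π)) =
      ⋂ (n : Fin k → ℕ) (_ : n i < l) (η : E n) (h : K),
        {u | inner ℂ (tm π (DirSum.single A n η) h) u = 0} := by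
    ext u
    simp only [Set.mem_iInter]
    rfl
  rw [this]
  exact isClosed_iInter fun n => isClosed_iInter fun _ => isClosed_iInter fun η =>
    isClosed_iInter fun h => isClosed_eq (continuous_const.inner continuous_id) continuous_const

theorem eq_zero_of_mem_fockTail (i : Fin k) {u : IntTensor (Fock A E) π}
    (hu : ∀ l, u ∈ fockTail E π i l) : u = 0 := by
  have h1 := eq_of_closedSpan_eq_top (DirSum.closedSpan_tm_single (E := E) π)
    (f := innerSL ℂ u) (g := 0) (by
      rintro _ ⟨n, η, h, rfl⟩
      rw [innerSL_apply_apply, ← inner_conj_symm, hu (n i + 1) n (Nat.lt_succ_self _) η h, map_zero]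
      rfl) u
  simpa using h1

theorem inner_single_induced_of_not_le {i : Fin k} {n : Fin k → ℕ} (hn : ¬ ε i ≤ n) (η : E n)
    (h : K) (ξ : E (ε i)) (u : IntTensor (Fock A E) π) :
    inner ℂ (tm π (DirSum.single A n η) h) ((X.induced π).T i ξ u) = 0 := by
  have : (innerSL ℂ (tm π (DirSum.single A n η) h)).comp ((X.induced π).T i ξ) = 0 :=
    intTensor_ext π fun x h' => by
      rw [ContinuousLinearMap.comp_apply, innerSL_apply_apply, X.induced_T_tm, inner_tm,
        X.ip_single_creation_of_not_le hn, map_zero]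
      simp
  exact congrArg (fun F => F u) this

theorem inner_single_mul_induced {i : Fin k} {m n : Fin k → ℕ} (hn : ε i + m = n)
    (ξ ξ' : E (ε i)) (η : E m) (h : K) (u : IntTensor (Fock A E) π) :
    inner ℂ (tm π (DirSum.single A n (X.mul hn ξ η)) h) ((X.induced π).T i ξ' u) =
      inner ℂ (tm π (DirSum.single A m (lact (ip A ξ' ξ) η)) h) u := by
  have : (innerSL ℂ (tm π (DirSum.single A n (X.mul hn ξ η)) h)).comp ((X.induced π).T i ξ') =
      innerSL ℂ (tm π (DirSum.single A m (lact (ip A ξ' ξ) η)) h) :=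
    intTensor_ext π fun x h' => by
      rw [ContinuousLinearMap.comp_apply, innerSL_apply_apply, innerSL_apply_apply,
        X.induced_T_tm, inner_tm, inner_tm, X.ip_single_mul_creation]
  exact congrArg (fun F => F u) this

/-- The bounded linear map `η ↦ δ_n(η) ⊗ h` from a fibre to `F(𝔼) ⊗_π K`. -/
def singleTmL (n : Fin k → ℕ) (h : K) : E n →L[ℂ] IntTensor (Fock A E) π :=
  LinearMap.mkContinuous
    { toFun := fun η => tm π (DirSum.single A n η) h
      map_add' := fun η ζ => by
        rw [← tm_add_left]
        congr 1
        refine DirSum.ext fun m => ?_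
        rcases eq_or_ne m n with rfl | hm
        · simp
        · simp [DirSum.single_ne hm]
      map_smul' := fun c η => by
        rw [RingHom.id_apply, ← tm_smul_left]
        congr 1
        refine DirSum.ext fun m => ?_
        rcases eq_or_ne m n with rfl | hm
        · simp
        · simp [DirSum.single_ne hm] } ‖h‖ fun η => by
    rw [mul_comm]
    refine (norm_tm_le π _ h).trans_eq ?_
    congr 1
    rw [← pow_left_inj₀ (CStarModule.norm_nonneg Aᵐᵒᵖ) (norm_nonneg _) two_ne_zero,
      ← norm_ip_self (A := A), ← norm_ip_self (A := A), DirSum.ip_single_single]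

theorem induced_T_mem_fockTail {i : Fin k} {l : ℕ} (ξ : E (ε i)) {u : IntTensor (Fock A E) π}
    (hu : u ∈ fockTail E π i l) : (X.induced π).T i ξ u ∈ fockTail E π i (l + 1) := by
  intro n hn η h
  rcases eq_or_ne (n i) 0 with h0 | h0
  · refine inner_single_induced_of_not_le X π (fun hle => ?_) η h ξ u
    have := hle i
    simp [h0] at this
  · obtain ⟨m, rfl⟩ := exists_single_add_of_apply_ne_zero h0
    have hm : m i < l := by
      simp only [Pi.add_apply, Pi.single_eq_same] at hn
      omega
    have := eq_of_closedSpan_eq_top (X.dense_mul (rfl : ε i + m = _))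
      (f := (innerSL ℂ ((X.induced π).T i ξ u)).comp (singleTmL π (ε i + m) h)) (g := 0) (by
        rintro _ ⟨x, y, rfl⟩
        change inner ℂ ((X.induced π).T i ξ u) (tm π (DirSum.single A _ (X.mul rfl x y)) h) = 0
        rw [← inner_conj_symm, inner_single_mul_induced, hu m hm, map_zero]) η
    change inner ℂ ((X.induced π).T i ξ u) (tm π (DirSum.single A _ η) h) = 0 at this
    rw [← inner_conj_symm, this, map_zero]

end Induced

variable {X}
variable {H : Type w} [NormedAddCommGroup H] [InnerProductSpace ℂ H] [CompleteSpace H]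
variable {R : IsometricRep X H}

/-- Words of length `l` in an induced representation take values in the tail of the Fock space, and
the tails have trivial intersection. -/
theorem IsometricRep.IsomorphicToInduced.Pinf_eq_zero (h : R.IsomorphicToInduced) (i : Fin k) :
    R.Pinf i = 0 := by
  obtain ⟨K, _, _, _, π, -, U, -, hU⟩ := h
  have hword : ∀ (l : ℕ) (ξ : Fin l → E (ε i)) (x : H),
      U ((List.ofFn fun r => R.T i (ξ r)).prod x) ∈ fockTail E π i l := by
    intro l
    induction l with
    | zero => exact fun _ _ n hn => absurd hn (Nat.not_lt_zero _)
    | succ l ih =>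
      intro ξ x
      rw [List.ofFn_succ, List.prod_cons]
      change U (R.T i (ξ 0) ((List.ofFn fun r => R.T i (ξ r.succ)).prod x)) ∈ _
      rw [hU]
      exact induced_T_mem_fockTail X π _ (ih _ x)
  rw [R.Pinf_eq_zero_iff]
  intro x hx
  have : U x = 0 := eq_zero_of_mem_fockTail π i fun l =>
    map_mem_of_mem_closedSpan (isClosed_fockTail π i l)
      U.toContinuousLinearEquiv.toContinuousLinearMap
      (by rintro _ ⟨ξ, y, rfl⟩; exact hword l ξ y) (hx l)
  exact (map_eq_zero_iff U U.injective).mp this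

namespace IsometricTuple

variable (R : IsometricTuple A E H)

instance : CompleteSpace R.jointWandering := R.isClosed_jointWandering.completeSpace_coe

/-- The restriction of `σ` to the joint wandering subspace. -/
def wanderingRep : A →⋆ₙₐ[ℂ] (R.jointWandering →L[ℂ] R.jointWandering) where
  toFun a := (R.σ a).restrict fun h hh => R.σ_mem_jointWandering hh a
  map_smul' c a := by ext h; simp
  map_zero' := by ext h; simp
  map_add' a b := by ext h; simp
  map_mul' a b := by ext h; simp
  map_star' a := by
    rw [ContinuousLinearMap.star_eq_adjoint, ContinuousLinearMap.eq_adjoint_iff]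
    intro x y
    rw [Submodule.coe_inner, Submodule.coe_inner]
    exact (R.inner_σ_left (star a) x y).trans (by rw [star_star]; rfl)

@[simp] theorem coe_wanderingRep (a : A) (h : R.jointWandering) :
    (R.wanderingRep a h : H) = R.σ a h := rfl

theorem isNondegenerate_wanderingRep : IsNondegenerate R.wanderingRep := by
  refine closedSpan_eq_top_of_orthogonal fun v hv => Subtype.ext ?_
  refine R.eq_zero_of_inner_σ_of_mem (fun a x hx => R.σ_mem_jointWandering hx a) v.2 ?_
  intro a x hx
  exact hv _ ⟨a, ⟨x, hx⟩, rfl⟩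

end IsometricTuple

/-- The unitary `T_n(ξ) h ↦ δ_n(ξ) ⊗ h` identifies a pure doubly commuting representation with the
one induced by the restriction of `σ` to the joint wandering subspace. -/
theorem IsometricRep.DoublyCommuting.isomorphicToInduced (hR : R.DoublyCommuting)
    (hP : ∀ i, R.Pinf i = 0) : R.IsomorphicToInduced := by
  let ι := Σ n : Fin k → ℕ, E n × R.jointWandering
  let x : ι → H := fun p => R.ext p.1 p.2.1 p.2.2
  let y : ι → IntTensor (Fock A E) R.wanderingRep := fun p =>
    tm R.wanderingRep (DirSum.single A p.1 p.2.1) p.2.2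
  have hx : (Submodule.span ℂ (Set.range x)).topologicalClosure = ⊤ := by
    have : Set.range x = R.generators := by
      ext z
      constructor
      · rintro ⟨⟨n, ξ, h⟩, rfl⟩
        exact ⟨n, ξ, h, h.2, rfl⟩
      · rintro ⟨n, ξ, h, hh, rfl⟩
        exact ⟨⟨n, ξ, h, hh⟩, rfl⟩
    rw [this]
    exact hR.generated_eq_top hP
  have hy : (Submodule.span ℂ (Set.range y)).topologicalClosure = ⊤ := by
    have : Set.range y = {z | ∃ (n : Fin k → ℕ) (ξ : E n) (h : R.jointWandering),
        tm R.wanderingRep (DirSum.single A n ξ) h = z} := by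
      ext z
      constructor
      · rintro ⟨⟨n, ξ, h⟩, rfl⟩
        exact ⟨n, ξ, h, rfl⟩
      · rintro ⟨n, ξ, h, rfl⟩
        exact ⟨⟨n, ξ, h⟩, rfl⟩
    rw [this]
    exact DirSum.closedSpan_tm_single R.wanderingRep
  have hxy : ∀ p q, inner ℂ (x p) (x q) = inner ℂ (y p) (y q) := by
    rintro ⟨m, ξ, h⟩ ⟨n, η, h'⟩
    change inner ℂ (R.ext m ξ h) (R.ext n η h') =
      inner ℂ (tm R.wanderingRep (DirSum.single A m ξ) h)
        (tm R.wanderingRep (DirSum.single A n η) h')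
    rw [inner_tm]
    rcases eq_or_ne m n with rfl | hmn
    · rw [R.inner_ext, DirSum.ip_single_single]
      rfl
    · rw [hR.inner_ext_of_ne hmn ξ η h.2 h'.2, DirSum.ip_single_single_of_ne hmn, map_zero]
      simp
  obtain ⟨U, hU⟩ := exists_unitary_of_gram x y hx hy hxy
  have hU' : ∀ (n : Fin k → ℕ) (ξ : E n) (h : R.jointWandering),
      U (R.ext n ξ h) = tm R.wanderingRep (DirSum.single A n ξ) h := fun n ξ h => hU ⟨n, ξ, h⟩
  -- Both sides of the intertwining relations are bounded in the vector, so it suffices to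
  -- compare them on the total family `x`.
  refine ⟨R.jointWandering, inferInstance, inferInstance, inferInstance, R.wanderingRep,
    R.isNondegenerate_wanderingRep, U, fun a h => ?_, fun i ξ h => ?_⟩
  · refine eq_of_closedSpan_eq_top hx
      (f := U.toContinuousLinearEquiv.toContinuousLinearMap.comp (R.σ a))
      (g := (leftRep (Fock A E) R.wanderingRep a).comp
        U.toContinuousLinearEquiv.toContinuousLinearMap) ?_ h
    rintro _ ⟨⟨n, η, h⟩, rfl⟩
    change U (R.σ a (R.ext n η h)) = leftRep (Fock A E) R.wanderingRep a (U (R.ext n η h))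
    rw [R.σ_ext, hU', hU', leftRep_tm, DirSum.lact_single]
  · refine eq_of_closedSpan_eq_top hx
      (f := U.toContinuousLinearEquiv.toContinuousLinearMap.comp (R.T i ξ))
      (g := ((X.induced R.wanderingRep).T i ξ).comp
        U.toContinuousLinearEquiv.toContinuousLinearMap) ?_ h
    rintro _ ⟨⟨n, η, h⟩, rfl⟩
    change U (R.T i ξ (R.ext n η h)) = (X.induced R.wanderingRep).T i ξ (U (R.ext n η h))
    rw [← R.ext_mul i rfl, hU', hU', X.induced_T_tm, X.creation_single rfl]

end Wold

end ProductSystemWold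

end

theorem lemma2p1 {A : Type*} [NonUnitalCStarAlgebra A] [PartialOrder A] [StarOrderedRing A]
    {k : ℕ} {E : (Fin k → ℕ) → Type*} [∀ n, NormedAddCommGroup (E n)]
    [∀ n, NormedSpace ℂ (E n)] [∀ n, SMul Aᵐᵒᵖ (E n)] [∀ n, CStarModule Aᵐᵒᵖ (E n)]
    [∀ n, ProductSystemWold.Correspondence A (E n)]
    (X : ProductSystemWold.ProductSystem A E)
    {H : Type*} [NormedAddCommGroup H] [InnerProductSpace ℂ H] [CompleteSpace H]
    (R : ProductSystemWold.IsometricRep X H) (hR : R.DoublyCommuting) :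
    R.IsomorphicToInduced ↔ ∀ i : Fin k, R.Pinf i = 0 :=
  ⟨fun h i => h.Pinf_eq_zero i, hR.isomorphicToInduced⟩
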